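/- There is a function $f:\mathbb{N}\to\mathbb{N}$ such that for every $t\in\mathbb{N}$, every finite simple bipartite graph with average degree at least $f(t)$ contains either a (not necessarily induced) subgraph isomorphic to the complete bipartite graph $K_{t,t}$, or an induced subgraph with average degree at least $t$ and girth at least $6$. Here the average degree of a graph with at least one vertex is the sum of its vertex degrees divided by its number of vertices, and the girth is the length of a shortest cycle ($\infty$ if there is no cycle). -/

import Mathlib

open Classical in
/-- The average degree of a finite graph: the sum of its vertex degrees divided by its number of
vertices. (On the graph without vertices this is `0 / 0 = 0`.) -/
noncomputable def SimpleGraph.averageDegree {V : Type*} [Fintype V] (G : SimpleGraph V) : ℚ :=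
  (∑ v : V, (G.degree v : ℚ)) / (Fintype.card V : ℚ)

/-! View the graph as the family of neighbourhoods in `B` of the vertices of `A`; girth at least 6
means that distinct neighbourhoods share at most one point. A minimal subgraph of average degree at
least `4 * D` has minimum degree above `2 * D` and average degree at most `6 * D`, so half of its
larger side `A` has degrees between `2 * D` and `24 * D` (`exists_minDegree_lt_and_sum_le`,
`exists_induce_of_minDegree`). Split `B` at degree `C * D`; half of `A` keeps degree at least `D`
into one of the two parts (`exists_hasDenseLinear_of_degree_range`).

If it is the low part, the graph is nearly regular. Without a `t` by `t` biclique its four-cycles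
number only a small fraction of `#A * (C * D) ^ 3` (`exists_sum_sq_codegree_le`), so a random sample
of density `10 * t / D` still has large average degree after the vertices of `A` on four-cycles are
deleted (`exists_hasDenseLinear_of_nearRegular`).

If it is the high part, that part is much smaller than `A`. Sampling it makes the degrees constant
without harming the imbalance (`exists_subset_degree_range`). Sets of `t + 2` points have fewer than
`t` common neighbours, and an induction lowers the size of the sets with bounded codegree until
pairs are reached, where a greedy choice works (`exists_ratio_hasDenseLinear`). The imbalance needed
depends on `t` only, so `C` can be fixed before `D`. -/

open Finset

/-! ### Very unbalanced graphs of bounded degree: induction on the set size -/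

section Bipartite

open scoped Classical

variable {α β : Type*}

/-- The neighbours of `a` in `B` with respect to the bipartite relation `r`. -/
noncomputable def relNbrs (r : α → β → Prop) (B : Finset β) (a : α) : Finset β := {b ∈ B | r a b}

/-- The common neighbours in `A` of the set `T`. -/
noncomputable def relCommon (r : α → β → Prop) (A : Finset α) (T : Finset β) : Finset α :=
  {a ∈ A | ∀ b ∈ T, r a b}

/-- `A` and `B` have subsets inducing a nonempty `C₄`-free bipartite graph of average degree at
least `t`. -/
def HasDenseLinear (r : α → β → Prop) (t : ℕ) (A : Finset α) (B : Finset β) : Prop :=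
  ∃ A' ⊆ A, ∃ B' ⊆ B, A'.Nonempty ∧
    (∀ a ∈ A', ∀ a' ∈ A', a ≠ a' → #(relNbrs r B' a ∩ relNbrs r B' a') ≤ 1) ∧
    t * (#A' + #B') ≤ 2 * ∑ a ∈ A', #(relNbrs r B' a)

/-- The relation has no complete bipartite `t` by `t` pattern. -/
def BicliqueFree (r : α → β → Prop) (t : ℕ) : Prop :=
  ∀ (X : Finset α) (Y : Finset β), #X = t → #Y = t → ¬ ∀ x ∈ X, ∀ y ∈ Y, r x y

variable {r : α → β → Prop}

theorem mem_relNbrs {B : Finset β} {a : α} {b : β} : b ∈ relNbrs r B a ↔ b ∈ B ∧ r a b := by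
  simp [relNbrs]

theorem mem_relCommon {A : Finset α} {T : Finset β} {a : α} :
    a ∈ relCommon r A T ↔ a ∈ A ∧ ∀ b ∈ T, r a b := by
  simp [relCommon]

theorem relNbrs_subset (r : α → β → Prop) (B : Finset β) (a : α) : relNbrs r B a ⊆ B :=
  filter_subset _ _

theorem relNbrs_eq_inter {B S : Finset β} (h : S ⊆ B) (a : α) :
    relNbrs r S a = relNbrs r B a ∩ S := by
  ext b; simp only [mem_relNbrs, mem_inter]; constructor
  · rintro ⟨h1, h2⟩; exact ⟨⟨h h1, h2⟩, h1⟩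
  · rintro ⟨⟨_, h2⟩, h1⟩; exact ⟨h1, h2⟩

theorem relNbrs_mono {B S : Finset β} (h : S ⊆ B) (a : α) : relNbrs r S a ⊆ relNbrs r B a :=
  filter_subset_filter _ h

theorem HasDenseLinear.mono {t : ℕ} {A A₁ : Finset α} {B B₁ : Finset β} (hA : A ⊆ A₁) (hB : B ⊆ B₁)
    (h : HasDenseLinear r t A B) : HasDenseLinear r t A₁ B₁ := by
  obtain ⟨A', hA', B', hB', h⟩ := h
  exact ⟨A', hA'.trans hA, B', hB'.trans hB, h⟩

theorem BicliqueFree.card_relCommon_lt {t : ℕ} (h : BicliqueFree r t) (A : Finset α) {T : Finset β}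
    (hT : t ≤ #T) : #(relCommon r A T) < t := by
  by_contra! hc
  obtain ⟨X, hX, hXc⟩ := exists_subset_card_eq hc
  obtain ⟨Y, hY, hYc⟩ := exists_subset_card_eq hT
  exact h X Y hXc hYc fun x hx y hy => (mem_relCommon.1 (hX hx)).2 y (hY hy)

/-- If all pairs have bounded codegree and `A` is much larger than `B`, a maximal set of pairwise
non-conflicting vertices of `A` is dense. -/
theorem hasDenseLinear_of_pair_codegree {t d M : ℕ} {A : Finset α} {B : Finset β}
    (hA : A.Nonempty) (hlow : ∀ a ∈ A, t ≤ #(relNbrs r B a)) (hup : ∀ a ∈ A, #(relNbrs r B a) ≤ d)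
    (hM : ∀ b ∈ B, ∀ b' ∈ B, b ≠ b' → #(relCommon r A {b, b'}) ≤ M)
    (hL : (d ^ 2 * M + 1) * #B ≤ #A) : HasDenseLinear r t A B := by
  let lin : Finset α → Prop := fun I =>
    ∀ a ∈ I, ∀ a' ∈ I, a ≠ a' → #(relNbrs r B a ∩ relNbrs r B a') ≤ 1
  obtain ⟨I, hI⟩ : ∃ I, Maximal (fun I => I ∈ A.powerset.filter lin) I :=
    exists_maximal ⟨∅, by simp [lin]⟩
  have hIA : I ⊆ A := mem_powerset.1 (mem_filter.1 hI.1).1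
  have hlin : lin I := (mem_filter.1 hI.1).2
  have hconf : ∀ a ∈ A, #{a' ∈ A | 2 ≤ #(relNbrs r B a ∩ relNbrs r B a')} ≤ d ^ 2 * M := by
    intro a ha
    have hsub : ({a' ∈ A | 2 ≤ #(relNbrs r B a ∩ relNbrs r B a')} : Finset α) ⊆
        (relNbrs r B a).offDiag.biUnion fun q => relCommon r A {q.1, q.2} := by
      intro a' ha'
      obtain ⟨h1, h2⟩ := mem_filter.1 ha'
      obtain ⟨b, hb, b', hb', hne⟩ := one_lt_card.1 h2
      simp only [mem_inter, mem_relNbrs] at hb hb'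
      refine mem_biUnion.2 ⟨(b, b'), mem_offDiag.2 ⟨mem_relNbrs.2 hb.1, mem_relNbrs.2 hb'.1, hne⟩, ?_⟩
      refine mem_relCommon.2 ⟨h1, ?_⟩
      simp [hb.2.2, hb'.2.2]
    refine (card_le_card hsub).trans ((card_biUnion_le_card_mul _ _ M ?_).trans ?_)
    · intro q hq
      obtain ⟨h1, h2, h3⟩ := mem_offDiag.1 hq
      exact hM _ (mem_relNbrs.1 h1).1 _ (mem_relNbrs.1 h2).1 h3
    · refine Nat.mul_le_mul_right _ ?_
      rw [offDiag_card, sq]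
      exact (Nat.sub_le _ _).trans (Nat.mul_le_mul (hup a ha) (hup a ha))
  have hcover : A ⊆ I.biUnion fun a => insert a {a' ∈ A | 2 ≤ #(relNbrs r B a ∩ relNbrs r B a')} := by
    intro x hx
    by_contra hcon
    simp only [mem_biUnion, mem_insert, mem_filter, not_exists, not_and, not_or] at hcon
    have hxI : x ∉ I := fun h => (hcon x h).1 rfl
    have hins : insert x I ∈ A.powerset.filter lin := by
      refine mem_filter.2 ⟨mem_powerset.2 (insert_subset hx hIA), ?_⟩
      intro a ha a' ha' hne
      rcases mem_insert.1 ha with rfl | haI <;> rcases mem_insert.1 ha' with rfl | haI'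
      · exact absurd rfl hne
      · have := (hcon a' haI').2 hx
        rw [inter_comm]; omega
      · have := (hcon a haI).2 hx
        omega
      · exact hlin a haI a' haI' hne
    exact hxI (hI.2 hins (subset_insert x I) (mem_insert_self x I))
  -- A maximal conflict-free set dominates the conflict graph, whose degrees are at most `d ^ 2 *
  -- M`. Hence `#B ≤ #I`, and degrees at least `t` on `I` alone give average degree `t`.
  have hcard : #A ≤ #I * (d ^ 2 * M + 1) := by
    refine (card_le_card hcover).trans (card_biUnion_le_card_mul _ _ _ fun a ha => ?_)
    exact (card_insert_le _ _).trans (Nat.add_le_add_right (hconf a (hIA ha)) 1)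
  have hBI : #B ≤ #I := by
    refine Nat.le_of_mul_le_mul_left (c := d ^ 2 * M + 1) ?_ (Nat.succ_pos _)
    linarith
  refine ⟨I, hIA, B, subset_rfl, ?_, hlin, ?_⟩
  · rw [nonempty_iff_ne_empty]; rintro rfl
    have := hA.card_pos
    rw [card_empty, Nat.zero_mul] at hcard; omega
  · have : #I * t ≤ ∑ a ∈ I, #(relNbrs r B a) := by
      rw [← smul_eq_mul]; exact card_nsmul_le_sum _ _ _ fun a ha => hlow a (hIA ha)
    nlinarith

/-- A set in which every small subset has few bad extensions contains a large subset free of bad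
sets. -/
theorem exists_subset_card_eq_forall_not {bad : Finset β → Prop} {N : Finset β} {s t k : ℕ}
    (hN : 2 ^ k * t + k < #N)
    (h : ∀ T ⊆ N, #T = s → #{b ∈ N \ T | bad (insert b T)} < t) :
    ∃ Q ⊆ N, #Q = k ∧ ∀ T ⊆ Q, #T = s + 1 → ¬ bad T := by
  suffices H : ∀ i ≤ k, ∃ Q ⊆ N, #Q = i ∧ ∀ T ⊆ Q, #T = s + 1 → ¬ bad T from H k le_rfl
  intro i
  induction i with
  | zero =>
    intro _
    refine ⟨∅, empty_subset _, rfl, fun T hT hc => ?_⟩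
    rw [subset_empty.1 hT] at hc; simp at hc
  | succ i ih =>
    intro hi
    obtain ⟨Q, hQN, hQc, hQ⟩ := ih (by omega)
    -- Greedy choice: the points that would complete a bad set with an `s`-subset of the current
    -- `Q`. There are at most `2 ^ k` such subsets, each forbidding fewer than `t` points.
    let F : Finset β := (powersetCard s Q).biUnion fun T => {b ∈ N \ T | bad (insert b T)}
    have hF : #F ≤ 2 ^ k * t := by
      refine (card_biUnion_le_card_mul _ _ t fun T hT => ?_).trans (Nat.mul_le_mul_right _ ?_)
      · obtain ⟨h1, h2⟩ := mem_powersetCard.1 hT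
        exact (h T (h1.trans hQN) h2).le
      · rw [card_powersetCard, hQc]
        exact (Nat.choose_le_two_pow _ _).trans (Nat.pow_le_pow_right (by norm_num) (by omega))
    obtain ⟨x, hxN, hx⟩ : ∃ x ∈ N, x ∉ F ∪ Q := by
      apply exists_mem_notMem_of_card_lt_card
      have := card_union_le F Q
      omega
    simp only [mem_union, not_or] at hx
    refine ⟨insert x Q, insert_subset hxN hQN, by rw [card_insert_of_notMem hx.2, hQc], ?_⟩
    intro T hT hTc hb
    by_cases hxT : x ∈ T
    · apply hx.1
      refine mem_biUnion.2 ⟨T.erase x, mem_powersetCard.2 ⟨?_, ?_⟩, mem_filter.2 ⟨?_, ?_⟩⟩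
      · intro y hy
        rcases mem_insert.1 (hT (mem_of_mem_erase hy)) with h | h
        · exact absurd h (ne_of_mem_erase hy)
        · exact h
      · rw [card_erase_of_mem hxT, hTc]; rfl
      · simp [hxN]
      · rwa [insert_erase hxT]
    · refine hQ T (fun y hy => ?_) hTc hb
      rcases mem_insert.1 (hT hy) with h | h
      · exact absurd (h ▸ hy) hxT
      · exact h

/-- Some subset `S` of `B` traces prescribed subsets on the neighbourhoods of many vertices. -/
theorem exists_trace_eq {d : ℕ} {A : Finset α} {B : Finset β} (Q : α → Finset β)
    (hQ : ∀ a ∈ A, Q a ⊆ relNbrs r B a) (hup : ∀ a ∈ A, #(relNbrs r B a) ≤ d) :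
    ∃ S ⊆ B, #A ≤ 2 ^ d * #{a ∈ A | relNbrs r S a = Q a} := by
  -- A uniformly random `S` has the prescribed trace at `a` with probability at least `2 ^ (-d)`,
  -- since its part outside the neighbourhood is free. Averaging over `S` then gives the claim.
  have hcount : ∀ a ∈ A, 2 ^ #B ≤ 2 ^ d * #{S ∈ B.powerset | relNbrs r S a = Q a} := by
    intro a ha
    have hinj : #((B \ relNbrs r B a).powerset) ≤ #{S ∈ B.powerset | relNbrs r S a = Q a} := by
      refine card_le_card_of_injOn (fun S => S ∪ Q a) ?_ ?_
      · intro S hS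
        have hS := mem_powerset.1 (mem_coe.1 hS)
        have hsub : S ∪ Q a ⊆ B :=
          union_subset (hS.trans sdiff_subset) ((hQ a ha).trans (relNbrs_subset _ _ _))
        refine mem_coe.2 (mem_filter.2 ⟨mem_powerset.2 hsub, ?_⟩)
        rw [relNbrs_eq_inter hsub]
        ext b
        simp only [mem_inter, mem_union]
        constructor
        · rintro ⟨h1, h2 | h2⟩
          · exact absurd h1 (mem_sdiff.1 (hS h2)).2
          · exact h2
        · exact fun h => ⟨hQ a ha h, Or.inr h⟩
      · intro S hS S' hS' heq
        have hS := mem_powerset.1 (mem_coe.1 hS)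
        have hS' := mem_powerset.1 (mem_coe.1 hS')
        have key : ∀ {S : Finset β}, S ⊆ B \ relNbrs r B a → (S ∪ Q a) \ Q a = S := by
          intro S hS
          rw [union_sdiff_right, Finset.sdiff_eq_self_iff_disjoint]
          exact disjoint_of_subset_left hS (disjoint_of_subset_right (hQ a ha) sdiff_disjoint)
        rw [← key hS, ← key hS']
        exact congrArg (· \ Q a) heq
    rw [card_powerset] at hinj
    have h1 : #B ≤ d + #(B \ relNbrs r B a) := by
      have := card_sdiff_add_card_eq_card (relNbrs_subset r B a)
      have := hup a ha
      omega
    calc 2 ^ #B ≤ 2 ^ (d + #(B \ relNbrs r B a)) := Nat.pow_le_pow_right (by norm_num) h1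
      _ = 2 ^ d * 2 ^ #(B \ relNbrs r B a) := pow_add _ _ _
      _ ≤ _ := Nat.mul_le_mul_left _ hinj
  by_contra! hcon
  have h1 : ∑ a ∈ A, 2 ^ #B ≤ ∑ S ∈ B.powerset, 2 ^ d * #{a ∈ A | relNbrs r S a = Q a} := by
    refine (sum_le_sum hcount).trans (le_of_eq ?_)
    rw [← mul_sum, ← mul_sum]
    congr 1
    simp only [card_filter]
    exact sum_comm
  have h2 : ∑ S ∈ B.powerset, 2 ^ d * #{a ∈ A | relNbrs r S a = Q a} < ∑ S ∈ B.powerset, #A :=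
    sum_lt_sum_of_nonempty (powerset_nonempty B) fun S hS => hcon S (mem_powerset.1 hS)
  simp only [sum_const, card_powerset, smul_eq_mul] at h1 h2
  linarith

/-- Double count the edges between `S` and the common neighbourhood of `T`. -/
theorem card_mul_le_of_forall_lt_card_relCommon {d Δ : ℕ} {A : Finset α} {B S T : Finset β}
    (hS : S ⊆ B) (hup : ∀ a ∈ A, #(relNbrs r B a) ≤ d)
    (h : ∀ b ∈ S, Δ ≤ #(relCommon r A (insert b T))) :
    #S * Δ ≤ #(relCommon r A T) * d := by
  calc #S * Δ ≤ ∑ b ∈ S, #(relCommon r A (insert b T)) := by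
        rw [← smul_eq_mul]; exact card_nsmul_le_sum _ _ _ h
    _ = ∑ b ∈ S, #{a ∈ relCommon r A T | r a b} := by
        refine sum_congr rfl fun b _ => congrArg card ?_
        ext a; simp only [mem_relCommon, mem_filter, forall_mem_insert]; tauto
    _ = ∑ a ∈ relCommon r A T, #(relNbrs r S a) := by
        simp only [card_filter, relNbrs]; exact sum_comm
    _ ≤ _ := by
        rw [← smul_eq_mul]
        refine sum_le_card_nsmul _ _ _ fun a ha => ?_
        exact (card_le_card (relNbrs_mono hS a)).trans (hup a (mem_relCommon.1 ha).1)

/-- Passing to the link of a popular set `T`. -/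
theorem hasDenseLinear_of_heavy_extensions {t d M s Δ : ℕ} {A A₁ : Finset α} {B : Finset β}
    (hA₁ : A₁.Nonempty) (hA₁A : A₁ ⊆ A) (hhalf : #A ≤ 2 * #A₁) (hd : 0 < d)
    (hup : ∀ a ∈ A, #(relNbrs r B a) ≤ d)
    (hM : ∀ T ⊆ B, #T = s + 2 → #(relCommon r A T) ≤ M)
    (hΔ : d * 2 ^ (d + 1) * (d ^ 2 * M + 1) ≤ Δ) (T : α → Finset β)
    (hT : ∀ a ∈ A₁, T a ⊆ relNbrs r B a ∧ #(T a) = s ∧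
      t ≤ #{b ∈ relNbrs r B a \ T a | Δ < #(relCommon r A (insert b (T a)))}) :
    HasDenseLinear r t A B := by
  -- Each `a` contains at most `2 ^ d` sets, so the codegrees of all chosen `T` sum to at most `2 ^
  -- d * #A`, while the fibres of `T` sum to `#A₁`. Some `T₀` is therefore chosen by a fixed
  -- proportion of its common neighbours.
  obtain ⟨T₀, hT₀, hpop⟩ : ∃ T₀ ∈ A₁.image T,
      #(relCommon r A T₀) ≤ 2 ^ (d + 1) * #{a ∈ A₁ | T a = T₀} := by
    apply exists_le_of_sum_le (hA₁.image T)
    rw [← mul_sum, ← card_eq_sum_card_image]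
    calc ∑ T₀ ∈ A₁.image T, #(relCommon r A T₀)
        = ∑ a ∈ A, #{T₀ ∈ A₁.image T | ∀ b ∈ T₀, r a b} := by
          simp only [relCommon, card_filter]; exact sum_comm
      _ ≤ ∑ a ∈ A, 2 ^ d := by
          refine sum_le_sum fun a ha => ?_
          calc _ ≤ #(relNbrs r B a).powerset := by
                refine card_le_card fun T₀ hT₀ => ?_
                obtain ⟨h1, h2⟩ := mem_filter.1 hT₀
                obtain ⟨a', ha', rfl⟩ := mem_image.1 h1
                exact mem_powerset.2 fun b hb => mem_relNbrs.2
                  ⟨relNbrs_subset _ _ _ ((hT a' ha').1 hb), h2 b hb⟩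
            _ = 2 ^ #(relNbrs r B a) := card_powerset _
            _ ≤ 2 ^ d := Nat.pow_le_pow_right (by norm_num) (hup a ha)
      _ = #A * 2 ^ d := by rw [sum_const, smul_eq_mul]
      _ ≤ 2 * #A₁ * 2 ^ d := Nat.mul_le_mul_right _ hhalf
      _ = _ := by ring
  obtain ⟨a₀, ha₀, rfl⟩ := mem_image.1 hT₀
  have hT₀B : T a₀ ⊆ B := (hT a₀ ha₀).1.trans (relNbrs_subset _ _ _)
  let A₂ : Finset α := {a ∈ A₁ | T a = T a₀}
  -- Heaviness makes `B₂` small compared with `A₂`, because every point of it accounts for more than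
  -- `Δ` common neighbours of `T₀`. A pair in `B₂` together with `T₀` is an `(s + 2)`-set, so pairs
  -- have codegree at most `M` in `A₂`.
  let B₂ : Finset β := {b ∈ B \ T a₀ | Δ < #(relCommon r A (insert b (T a₀)))}
  have hB₂ : B₂ ⊆ B := (filter_subset _ _).trans sdiff_subset
  have hA₂ : A₂ ⊆ A := (filter_subset _ _).trans hA₁A
  refine HasDenseLinear.mono hA₂ hB₂ (hasDenseLinear_of_pair_codegree (d := d) (M := M) ?_ ?_ ?_ ?_ ?_)
  · exact ⟨a₀, mem_filter.2 ⟨ha₀, rfl⟩⟩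
  · intro a ha
    obtain ⟨h1, h2⟩ := mem_filter.1 ha
    refine (hT a h1).2.2.trans (card_le_card fun b hb => ?_)
    obtain ⟨h3, h4⟩ := mem_filter.1 hb
    obtain ⟨h5, h6⟩ := mem_sdiff.1 h3
    rw [h2] at h4 h6
    rw [mem_relNbrs] at h5 ⊢
    exact ⟨mem_filter.2 ⟨mem_sdiff.2 ⟨h5.1, h6⟩, h4⟩, h5.2⟩
  · exact fun a ha => (card_le_card (relNbrs_mono hB₂ a)).trans (hup a (hA₂ ha))
  · intro b hb b' hb' hne
    have hbT := (mem_sdiff.1 (mem_filter.1 hb).1).2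
    have hbT' := (mem_sdiff.1 (mem_filter.1 hb').1).2
    refine le_trans (card_le_card fun a ha => ?_) (hM (insert b (insert b' (T a₀))) ?_ ?_)
    · obtain ⟨h1, h2⟩ := mem_relCommon.1 ha
      obtain ⟨h3, h4⟩ := mem_filter.1 h1
      refine mem_relCommon.2 ⟨hA₂ h1, ?_⟩
      simp only [forall_mem_insert, mem_singleton, forall_eq] at h2 ⊢
      exact ⟨h2.1, h2.2, fun c hc => (mem_relNbrs.1 ((hT a h3).1 (h4 ▸ hc))).2⟩
    · exact insert_subset (hB₂ hb) (insert_subset (hB₂ hb') hT₀B)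
    · rw [card_insert_of_notMem (by simp [hne, hbT]), card_insert_of_notMem hbT', (hT a₀ ha₀).2.1]
  · have h1 := card_mul_le_of_forall_lt_card_relCommon (r := r) (Δ := Δ) (T := T a₀) hB₂ hup
      fun b hb => (mem_filter.1 hb).2.le
    refine Nat.le_of_mul_le_mul_left (c := d * 2 ^ (d + 1)) ?_ (by positivity)
    calc d * 2 ^ (d + 1) * ((d ^ 2 * M + 1) * #B₂) = d * 2 ^ (d + 1) * (d ^ 2 * M + 1) * #B₂ := by ring
      _ ≤ Δ * #B₂ := Nat.mul_le_mul_right _ hΔ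
      _ = #B₂ * Δ := mul_comm _ _
      _ ≤ _ := h1
      _ ≤ 2 ^ (d + 1) * #A₂ * d := Nat.mul_le_mul_right _ hpop
      _ = _ := by ring

/-- A very unbalanced bipartite graph in which all sets of a fixed size have bounded codegree
contains a dense induced `C₄`-free subgraph. -/
theorem exists_ratio_hasDenseLinear (t s : ℕ) : ∃ k : ℕ, ∀ d M : ℕ, ∃ L : ℕ,
    ∀ {α β : Type*} (r : α → β → Prop) (A : Finset α) (B : Finset β), A.Nonempty →
      (∀ a ∈ A, k ≤ #(relNbrs r B a)) → (∀ a ∈ A, #(relNbrs r B a) ≤ d) →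
      (∀ T ⊆ B, #T = s + 2 → #(relCommon r A T) ≤ M) → L * #B ≤ #A → HasDenseLinear r t A B := by
  induction s with
  | zero =>
    refine ⟨t, fun d M => ⟨d ^ 2 * M + 1, fun r A B hA hlow hup hM hL => ?_⟩⟩
    refine hasDenseLinear_of_pair_codegree hA hlow hup (fun b hb b' hb' hne => ?_) hL
    exact hM _ (insert_subset hb (singleton_subset_iff.2 hb')) (card_pair hne)
  | succ s ih =>
    obtain ⟨k, hk⟩ := ih
    refine ⟨2 ^ k * t + k + 1, fun d M => ?_⟩
    let Δ := d * 2 ^ (d + 1) * (d ^ 2 * M + 1)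
    obtain ⟨L, hL⟩ := hk d Δ
    refine ⟨2 ^ (d + 1) * L, fun {α β} r A B hA hlow hup hM hLA => ?_⟩
    let heavy : Finset β → Prop := fun T => Δ < #(relCommon r A T)
    -- Either half of `A` is sparse, and the sets `Q` serve as the neighbourhoods for the induction
    -- hypothesis with codegree bound `Δ`, or half is not, and one passes to the link of a popular
    -- set.
    let sparse : α → Prop := fun a =>
      ∃ Q ⊆ relNbrs r B a, #Q = k ∧ ∀ T ⊆ Q, #T = s + 1 + 1 → ¬ heavy T
    have hsplit : #{a ∈ A | sparse a} + #{a ∈ A | ¬ sparse a} = #A :=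
      card_filter_add_card_filter_not _
    have hApos := hA.card_pos
    rcases le_total #{a ∈ A | ¬ sparse a} #{a ∈ A | sparse a} with hle | hle
    · have hsp : ∀ a, ∃ Q : Finset β, sparse a → Q ⊆ relNbrs r B a ∧ #Q = k ∧
          ∀ T ⊆ Q, #T = s + 1 + 1 → ¬ heavy T := by
        intro a
        by_cases h : sparse a
        · obtain ⟨Q, hQ⟩ := h; exact ⟨Q, fun _ => hQ⟩
        · exact ⟨∅, fun h' => absurd h' h⟩
      choose Q hQ using hsp
      obtain ⟨S, hSB, hS⟩ := exists_trace_eq (r := r) (A := {a ∈ A | sparse a}) (B := B) (d := d) Q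
        (fun a ha => (hQ a (mem_filter.1 ha).2).1) (fun a ha => hup a (mem_filter.1 ha).1)
      let A₂ : Finset α := {a ∈ ({a ∈ A | sparse a} : Finset α) | relNbrs r S a = Q a}
      have hA₂ : ∀ a ∈ A₂, a ∈ A ∧ sparse a ∧ relNbrs r S a = Q a := fun a ha => by
        simpa [A₂, and_assoc] using ha
      have hbig : #A ≤ 2 ^ (d + 1) * #A₂ := by
        rw [pow_succ]; change _ ≤ 2 ^ d * #A₂ at hS; linarith
      refine HasDenseLinear.mono (fun a ha => (hA₂ a ha).1) hSB (hL r A₂ S ?_ ?_ ?_ ?_ ?_)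
      · rw [← card_pos]; exact Nat.pos_of_mul_pos_left (hApos.trans_le hbig)
      · intro a ha
        obtain ⟨_, h2, h3⟩ := hA₂ a ha
        rw [h3, (hQ a h2).2.1]
      · exact fun a ha => (card_le_card (relNbrs_mono hSB a)).trans (hup a (hA₂ a ha).1)
      · intro T hTS hTc
        -- On the traces `Q a` a heavy set has no common neighbour at all, and any other set has at
        -- most `Δ`.
        by_cases hheavy : heavy T
        · have : relCommon r A₂ T = ∅ := by
            refine eq_empty_of_forall_notMem fun a ha => ?_
            obtain ⟨h1, h2⟩ := mem_relCommon.1 ha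
            obtain ⟨_, h3, h4⟩ := hA₂ a h1
            refine (hQ a h3).2.2 T ?_ hTc hheavy
            rw [← h4]
            exact fun b hb => mem_relNbrs.2 ⟨hTS hb, h2 b hb⟩
          simp [this]
        · refine le_trans (card_le_card fun a ha => ?_) (not_lt.1 hheavy)
          obtain ⟨h1, h2⟩ := mem_relCommon.1 ha
          exact mem_relCommon.2 ⟨(hA₂ a h1).1, h2⟩
      · refine Nat.le_of_mul_le_mul_left (c := 2 ^ (d + 1)) ?_ (by positivity)
        calc _ ≤ 2 ^ (d + 1) * (L * #B) := by gcongr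
          _ = 2 ^ (d + 1) * L * #B := by ring
          _ ≤ _ := hLA.trans hbig
    · have hT : ∀ a, ∃ T : Finset β, a ∈ ({a ∈ A | ¬ sparse a} : Finset α) → T ⊆ relNbrs r B a ∧
          #T = s + 1 ∧ t ≤ #{b ∈ relNbrs r B a \ T | Δ < #(relCommon r A (insert b T))} := by
        intro a
        by_cases h : a ∈ ({a ∈ A | ¬ sparse a} : Finset α)
        · by_contra! hcon
          obtain ⟨h1, h2⟩ := mem_filter.1 h
          -- If every `(s + 1)`-subset had fewer than `t` heavy extensions, the greedy choice would
          -- make `a` sparse.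
          refine h2 (exists_subset_card_eq_forall_not (bad := heavy) (t := t) ?_ fun T hTN hTc => ?_)
          · exact Nat.lt_of_succ_le (hlow a h1)
          · simpa only [heavy] using (hcon T).2 hTN hTc
        · exact ⟨∅, fun h' => absurd h' h⟩
      choose T hT using hT
      have hne : ({a ∈ A | ¬ sparse a} : Finset α).Nonempty := by rw [← card_pos]; omega
      refine hasDenseLinear_of_heavy_extensions (s := s + 1) (Δ := Δ) hne (filter_subset _ _)
        (by omega) ?_ hup hM le_rfl T hT
      obtain ⟨a, ha⟩ := hA
      have := hlow a ha
      have := hup a ha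
      omega

end Bipartite

/-! ### Random sampling, and counting four-cycles without bicliques -/

section Sampling

open scoped Classical

variable {α β : Type*}

/-- The probability of `S` when every element of `B` is chosen independently with probability
`p`. -/
noncomputable def sampleWeight (p : ℝ) (B S : Finset β) : ℝ :=
  (∏ _b ∈ S, p) * ∏ _b ∈ B \ S, (1 - p)

/-- The indicator of `T ⊆ S`. -/
noncomputable def subsetInd (T S : Finset β) : ℝ := if T ⊆ S then 1 else 0

theorem subsetInd_nonneg (T S : Finset β) : 0 ≤ subsetInd T S := by
  unfold subsetInd; split_ifs <;> norm_num

theorem subsetInd_of_subset {T S : Finset β} (h : T ⊆ S) : subsetInd T S = 1 := if_pos h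

theorem subsetInd_mul (T U S : Finset β) :
    subsetInd T S * subsetInd U S = subsetInd (T ∪ U) S := by
  simp only [subsetInd, union_subset_iff]; split_ifs <;> simp_all

theorem sampleWeight_pos {p : ℝ} (h0 : 0 < p) (h1 : p < 1) (B S : Finset β) :
    0 < sampleWeight p B S :=
  mul_pos (prod_pos fun _ _ => h0) (prod_pos fun _ _ => sub_pos.2 h1)

theorem sum_sampleWeight_mul_subsetInd (p : ℝ) {B T : Finset β} (h : T ⊆ B) :
    ∑ S ∈ B.powerset, sampleWeight p B S * subsetInd T S = p ^ #T := by
  -- Setting the weight of "not chosen" to 0 on `T` kills exactly the terms with `T ⊄ S`.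
  have key := prod_add (fun _ : β => p) (fun b => if b ∈ T then 0 else 1 - p) B
  have hl : ∏ b ∈ B, (p + if b ∈ T then 0 else 1 - p) = p ^ #T := by
    have : ∀ b ∈ B, (p + if b ∈ T then 0 else 1 - p) = if b ∈ T then p else 1 := by
      intro b _; split_ifs <;> ring
    rw [prod_congr rfl this, prod_ite_mem, prod_const, inter_eq_right.2 h]
  rw [← hl, key]
  refine sum_congr rfl fun S _ => ?_
  rw [sampleWeight, mul_assoc]
  congr 1
  by_cases hTS : T ⊆ S
  · rw [subsetInd_of_subset hTS, mul_one]
    refine prod_congr rfl fun b hb => ?_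
    rw [if_neg fun hbT => (mem_sdiff.1 hb).2 (hTS hbT)]
  · obtain ⟨b, hbT, hbS⟩ := not_subset.1 hTS
    rw [subsetInd, if_neg hTS, mul_zero]
    refine (prod_eq_zero (mem_sdiff.2 ⟨h hbT, hbS⟩) ?_).symm
    exact if_pos hbT

theorem sum_sampleWeight (p : ℝ) (B : Finset β) :
    ∑ S ∈ B.powerset, sampleWeight p B S = 1 := by
  simpa [subsetInd] using sum_sampleWeight_mul_subsetInd p (empty_subset B)

theorem exists_le_of_weighted_sum_le {ι : Type*} {s : Finset ι} {w f : ι → ℝ} {c : ℝ}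
    (hw : ∀ i ∈ s, 0 < w i) (h1 : ∑ i ∈ s, w i = 1) (h : ∑ i ∈ s, w i * f i ≤ c) :
    ∃ i ∈ s, f i ≤ c := by
  have hs : s.Nonempty := by
    rw [nonempty_iff_ne_empty]; rintro rfl; simp at h1
  obtain ⟨i, hi, hle⟩ := exists_le_of_sum_le (f := fun i => w i * f i) (g := fun i => w i * c) hs
    (by rw [← sum_mul, h1, one_mul]; exact h)
  exact ⟨i, hi, le_of_mul_le_mul_left hle (hw i hi)⟩

theorem card_inter_eq_sum_subsetInd (N S : Finset β) :
    (#(N ∩ S) : ℝ) = ∑ b ∈ N, subsetInd {b} S := by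
  simp only [subsetInd, singleton_subset_iff, sum_boole, filter_mem_eq_inter]

/-- The variance of a binomial variable is at most its mean; this feeds Chebyshev's inequality. -/
theorem sum_sampleWeight_mul_sq_sub_le (p : ℝ) {B N : Finset β} (hN : N ⊆ B) :
    ∑ S ∈ B.powerset, sampleWeight p B S * ((#(N ∩ S) : ℝ) - p * #N) ^ 2 ≤ p * #N := by
  have hfirst : ∑ S ∈ B.powerset, sampleWeight p B S * (#(N ∩ S) : ℝ) = p * #N := by
    simp only [card_inter_eq_sum_subsetInd, mul_sum]
    rw [sum_comm, sum_congr rfl fun b hb =>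
      sum_sampleWeight_mul_subsetInd p (singleton_subset_iff.2 (hN hb))]
    simp [mul_comm]
  have hsecond : ∑ S ∈ B.powerset, sampleWeight p B S * (#(N ∩ S) : ℝ) ^ 2 ≤
      p * #N + p ^ 2 * #N ^ 2 := by
    have h1 : ∀ S, sampleWeight p B S * (#(N ∩ S) : ℝ) ^ 2 =
        ∑ b ∈ N, ∑ b' ∈ N, sampleWeight p B S * subsetInd {b, b'} S := by
      intro S
      rw [card_inter_eq_sum_subsetInd, sq, sum_mul_sum]
      simp only [mul_sum, subsetInd_mul]
      rfl
    simp only [h1]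
    rw [sum_comm]
    have h2 : ∀ b ∈ N, ∑ S ∈ B.powerset, ∑ b' ∈ N, sampleWeight p B S * subsetInd {b, b'} S ≤
        p + p ^ 2 * #N := by
      intro b hb
      rw [sum_comm]
      have h3 : ∀ b' ∈ N, ∑ S ∈ B.powerset, sampleWeight p B S * subsetInd {b, b'} S ≤
          (if b = b' then p else 0) + p ^ 2 := by
        intro b' hb'
        rw [sum_sampleWeight_mul_subsetInd p
          (insert_subset (hN hb) (singleton_subset_iff.2 (hN hb')))]
        split_ifs with h
        · subst h; simp; positivity
        · rw [card_pair h]; simp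
      refine (sum_le_sum h3).trans (le_of_eq ?_)
      rw [sum_add_distrib, sum_ite_eq, if_pos hb]
      simp [mul_comm]
    refine (sum_le_sum h2).trans (le_of_eq ?_)
    simp; ring
  have hexp : ∑ S ∈ B.powerset, sampleWeight p B S * ((#(N ∩ S) : ℝ) - p * #N) ^ 2 =
      ∑ S ∈ B.powerset, sampleWeight p B S * (#(N ∩ S) : ℝ) ^ 2
        - 2 * (p * #N) * ∑ S ∈ B.powerset, sampleWeight p B S * (#(N ∩ S) : ℝ)
        + (p * #N) ^ 2 * ∑ S ∈ B.powerset, sampleWeight p B S := by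
    simp only [mul_sum, ← sum_sub_distrib, ← sum_add_distrib]
    exact sum_congr rfl fun S _ => by ring
  rw [hexp, hfirst, sum_sampleWeight]
  nlinarith

variable {r : α → β → Prop}

/-- Sampling `B` reduces the degrees of half of `A` to a bounded range. -/
theorem exists_subset_degree_range {k D : ℕ} (hk : 96 ≤ k) (hD : 2 * k < D) {A : Finset α}
    {B : Finset β} (hlow : ∀ a ∈ A, D ≤ #(relNbrs r B a))
    (hup : ∀ a ∈ A, #(relNbrs r B a) ≤ 24 * D) :
    ∃ S ⊆ B, #A ≤ 2 * #{a ∈ A | k ≤ #(relNbrs r S a) ∧ #(relNbrs r S a) ≤ 49 * k} := by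
  have hk' : (96 : ℝ) ≤ k := by exact_mod_cast hk
  have hD' : 2 * (k : ℝ) < D := by exact_mod_cast hD
  have hD0 : (0 : ℝ) < D := by linarith
  -- The expected degrees lie in `[2k, 48k]`, so leaving `[k, 49k]` is a deviation of at least `k`.
  -- By Chebyshev the expected bad proportion is at most `48 / k ≤ 1 / 2`.
  set p : ℝ := 2 * k / D with hp
  have hp0 : 0 < p := by positivity
  have hp1 : p < 1 := by rw [hp, div_lt_one hD0]; exact hD'
  have hpD : p * D = 2 * k := by rw [hp]; field_simp
  let X : α → Finset β → ℝ := fun a S => (#(relNbrs r B a ∩ S) : ℝ)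
  let m : α → ℝ := fun a => p * #(relNbrs r B a)
  have hm : ∀ a ∈ A, 2 * (k : ℝ) ≤ m a ∧ m a ≤ 48 * k := by
    intro a ha
    have h1 : (D : ℝ) ≤ #(relNbrs r B a) := by exact_mod_cast hlow a ha
    have h2 : (#(relNbrs r B a) : ℝ) ≤ 24 * D := by exact_mod_cast hup a ha
    exact ⟨by rw [← hpD]; exact mul_le_mul_of_nonneg_left h1 hp0.le, by
      calc m a ≤ p * (24 * D) := mul_le_mul_of_nonneg_left h2 hp0.le
        _ = 24 * (p * D) := by ring
        _ = 48 * k := by rw [hpD]; ring⟩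
  have hE : ∑ S ∈ B.powerset, sampleWeight p B S * ∑ a ∈ A, (X a S - m a) ^ 2 ≤
      #A * (48 * k) := by
    simp only [mul_sum]
    rw [sum_comm, ← nsmul_eq_mul]
    refine sum_le_card_nsmul _ _ _ fun a ha => ?_
    exact (sum_sampleWeight_mul_sq_sub_le p (relNbrs_subset r B a)).trans (hm a ha).2
  obtain ⟨S, hS, hle⟩ := exists_le_of_weighted_sum_le
    (fun S _ => sampleWeight_pos hp0 hp1 B S) (sum_sampleWeight p B) hE
  have hSB := mem_powerset.1 hS
  refine ⟨S, hSB, ?_⟩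
  have hsplit : #{a ∈ A | k ≤ #(relNbrs r S a) ∧ #(relNbrs r S a) ≤ 49 * k} +
      #{a ∈ A | ¬ (k ≤ #(relNbrs r S a) ∧ #(relNbrs r S a) ≤ 49 * k)} = #A :=
    card_filter_add_card_filter_not _
  have hbad : (#{a ∈ A | ¬ (k ≤ #(relNbrs r S a) ∧ #(relNbrs r S a) ≤ 49 * k)} : ℝ) * k ^ 2 ≤
      #A * (48 * k) := by
    refine le_trans ?_ hle
    rw [← nsmul_eq_mul]
    refine (card_nsmul_le_sum _ (fun a => (X a S - m a) ^ 2) _ fun a ha => ?_).trans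
      (sum_le_sum_of_subset_of_nonneg (filter_subset _ _) fun _ _ _ => sq_nonneg _)
    obtain ⟨h1, h2⟩ := mem_filter.1 ha
    obtain ⟨h3, h4⟩ := hm a h1
    rw [relNbrs_eq_inter hSB] at h2
    rw [not_and_or, not_le, not_le] at h2
    rcases h2 with h2 | h2
    · have h5 : X a S < k := Nat.cast_lt.2 h2
      nlinarith
    · have h5 : ((49 * k : ℕ) : ℝ) < X a S := Nat.cast_lt.2 h2
      push_cast at h5
      nlinarith
  have hbad' : 2 * (#{a ∈ A | ¬ (k ≤ #(relNbrs r S a) ∧ #(relNbrs r S a) ≤ 49 * k)} : ℝ) ≤ #A := by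
    have hk0 : (0 : ℝ) < k := by linarith
    have h1 : (#{a ∈ A | ¬ (k ≤ #(relNbrs r S a) ∧ #(relNbrs r S a) ≤ 49 * k)} : ℝ) * k ≤
        #A * 48 := by
      refine le_of_mul_le_mul_right ?_ hk0
      linarith
    have h2 : (0 : ℝ) ≤ #{a ∈ A | ¬ (k ≤ #(relNbrs r S a) ∧ #(relNbrs r S a) ≤ 49 * k)} :=
      Nat.cast_nonneg _
    nlinarith
  have hbad'' : 2 * #{a ∈ A | ¬ (k ≤ #(relNbrs r S a) ∧ #(relNbrs r S a) ≤ 49 * k)} ≤ #A := by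
    exact_mod_cast hbad'
  omega

/-- In a biclique-free relation only boundedly many vertices see a positive proportion of a large
set. -/
theorem exists_card_lt_of_bicliqueFree (t q : ℕ) (hq : 0 < q) : ∃ M m₀ : ℕ,
    ∀ {α β : Type*} {r : α → β → Prop}, BicliqueFree r t → ∀ m ≥ m₀, ∀ Y : Finset β, #Y ≤ m →
      ∀ X : Finset α, (∀ x ∈ X, m ≤ q * #(relNbrs r Y x)) → #X < M := by
  -- With `M` such vertices, points of `Y` see at least `t + 1` of them on average over `m`, so at
  -- least `m / M` points see `t` or more.
  let M := q * (t + 1)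
  have hM : 0 < M := Nat.mul_pos hq (Nat.succ_pos t)
  refine ⟨M, M * (2 ^ M * t), fun {α β r} hr m hm Y hY X hX => ?_⟩
  by_contra! hcon
  obtain ⟨X₀, hX₀, hcard⟩ := exists_subset_card_eq hcon
  let N : β → Finset α := fun y => {x ∈ X₀ | r x y}
  let Y₁ : Finset β := {y ∈ Y | t ≤ #(N y)}
  have h1 : m * (t + 1) ≤ ∑ y ∈ Y, #(N y) := by
    have h2 : ∑ y ∈ Y, #(N y) = ∑ x ∈ X₀, #(relNbrs r Y x) := by
      simp only [N, relNbrs, card_filter]; exact sum_comm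
    rw [h2]
    refine Nat.le_of_mul_le_mul_left (c := q) ?_ hq
    calc q * (m * (t + 1)) = #X₀ * m := by rw [hcard]; ring
      _ ≤ ∑ x ∈ X₀, q * #(relNbrs r Y x) := by
        rw [← smul_eq_mul]; exact card_nsmul_le_sum _ _ _ fun x hx => hX x (hX₀ hx)
      _ = _ := (mul_sum _ _ _).symm
  have h2 : ∑ y ∈ Y, #(N y) ≤ m * t + #Y₁ * M := by
    calc ∑ y ∈ Y, #(N y) ≤ ∑ y ∈ Y, (t + if t ≤ #(N y) then M else 0) := by
          refine sum_le_sum fun y _ => ?_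
          split_ifs with h
          · have : #(N y) ≤ M := hcard ▸ card_le_card (filter_subset _ _)
            omega
          · omega
      _ = #Y * t + #Y₁ * M := by
          rw [sum_add_distrib, ← sum_filter]; simp [Y₁]
      _ ≤ _ := by gcongr
  have h3 : 2 ^ M * t ≤ #Y₁ := by
    refine Nat.le_of_mul_le_mul_left (c := M) ?_ hM
    nlinarith
  -- Pigeonhole over the `2 ^ M` possible traces: `t` points with a common trace of size at least
  -- `t` form a biclique.
  obtain ⟨Z, _, hZ⟩ := exists_le_card_fiber_of_mul_le_card_of_maps_to (s := Y₁) (t := X₀.powerset)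
    (f := N) (n := t) (fun y _ => mem_powerset.2 (filter_subset _ _))
    ⟨∅, empty_mem_powerset _⟩ (by rw [card_powerset, hcard]; exact h3)
  rcases Nat.eq_zero_or_pos t with rfl | ht
  · exact hr ∅ ∅ rfl rfl (by simp)
  obtain ⟨y₀, hy₀⟩ := card_pos.1 (ht.trans_le hZ)
  obtain ⟨hy₀, hy₀Z⟩ := mem_filter.1 hy₀
  have hZt : t ≤ #Z := hy₀Z ▸ (mem_filter.1 hy₀).2
  obtain ⟨X', hX', hXc⟩ := exists_subset_card_eq hZt
  obtain ⟨Y', hY', hYc⟩ := exists_subset_card_eq hZ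
  refine hr X' Y' hXc hYc fun x hx y hy => ?_
  have h4 := (mem_filter.1 (hY' hy)).2
  have h5 := hX' hx
  rw [← h4] at h5
  exact (mem_filter.1 h5).2

/-- Biclique-free graphs of bounded maximum degree have few four-cycles. -/
theorem exists_sum_sq_codegree_le (t q : ℕ) (hq : 0 < q) : ∃ m₀ : ℕ,
    ∀ {α β : Type*} {r : α → β → Prop}, BicliqueFree r t → ∀ m ≥ m₀,
      ∀ (A : Finset α) (B : Finset β), (∀ a ∈ A, #(relNbrs r B a) ≤ m) →
        (∀ b ∈ B, #{a ∈ A | r a b} ≤ m) →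
        q * ∑ a ∈ A, ∑ a' ∈ A, #(relNbrs r B a ∩ relNbrs r B a') ^ 2 ≤ 2 * #A * m ^ 3 := by
  obtain ⟨M, m₀, h⟩ := exists_card_lt_of_bicliqueFree t q hq
  refine ⟨max m₀ (q * M), fun {α β r} hr m hm A B hA hB => ?_⟩
  have hm₀ : m₀ ≤ m := (le_max_left _ _).trans hm
  have hqM : q * M ≤ m := (le_max_right _ _).trans hm
  -- For an edge `ab`, fewer than `M` neighbours of `b` see a `1 / q` proportion of `m` inside the
  -- neighbourhood of `a`. Those contribute at most `m` each, all others less than `m / q`.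
  have hedge : ∀ a ∈ A, ∀ b ∈ B,
      q * ∑ a' ∈ A with r a' b, #(relNbrs r B a ∩ relNbrs r B a') ≤ 2 * m ^ 2 := by
    intro a ha b hb
    let X : Finset α := {a' ∈ A | r a' b}
    let Y := relNbrs r B a
    have hYX : ∀ x, relNbrs r B a ∩ relNbrs r B x = relNbrs r Y x := fun x => by
      rw [relNbrs_eq_inter (relNbrs_subset r B a), inter_comm]
    have hheavy := h hr m hm₀ Y (hA a ha) {x ∈ X | m ≤ q * #(relNbrs r Y x)}
      fun x hx => (mem_filter.1 hx).2
    calc q * ∑ x ∈ X, #(relNbrs r B a ∩ relNbrs r B x) = ∑ x ∈ X, q * #(relNbrs r Y x) := by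
          rw [mul_sum]; exact sum_congr rfl fun x _ => by rw [hYX]
      _ ≤ ∑ x ∈ X, (m + if m ≤ q * #(relNbrs r Y x) then q * m else 0) := by
          refine sum_le_sum fun x _ => ?_
          split_ifs with hx
          · have : #(relNbrs r Y x) ≤ m := (card_le_card (relNbrs_subset _ _ _)).trans (hA a ha)
            have := Nat.mul_le_mul_left q this
            omega
          · omega
      _ = #X * m + #{x ∈ X | m ≤ q * #(relNbrs r Y x)} * (q * m) := by
          rw [sum_add_distrib, ← sum_filter]; simp
      _ ≤ m * m + M * (q * m) := by
          gcongr
          exact hB b hb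
      _ = m * m + (q * M) * m := by ring
      _ ≤ m * m + m * m := by gcongr
      _ = _ := by ring
  have hrow : ∀ a ∈ A,
      q * ∑ a' ∈ A, #(relNbrs r B a ∩ relNbrs r B a') ^ 2 ≤ 2 * m ^ 3 := by
    intro a ha
    have hswap : ∑ a' ∈ A, #(relNbrs r B a ∩ relNbrs r B a') ^ 2 =
        ∑ b ∈ relNbrs r B a, ∑ a' ∈ A with r a' b, #(relNbrs r B a ∩ relNbrs r B a') := by
      simp only [sum_filter]
      rw [sum_comm]
      refine sum_congr rfl fun a' _ => ?_
      rw [← sum_filter, sum_const, smul_eq_mul, sq]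
      congr 2
      ext b; simp only [mem_inter, mem_relNbrs, mem_filter]; tauto
    rw [hswap, mul_sum]
    calc _ ≤ ∑ _b ∈ relNbrs r B a, 2 * m ^ 2 :=
          sum_le_sum fun b hb => hedge a ha b (relNbrs_subset _ _ _ hb)
      _ = #(relNbrs r B a) * (2 * m ^ 2) := by rw [sum_const, smul_eq_mul]
      _ ≤ m * (2 * m ^ 2) := Nat.mul_le_mul_right _ (hA a ha)
      _ = _ := by ring
  rw [mul_sum]
  refine (sum_le_sum hrow).trans (le_of_eq ?_)
  rw [sum_const, smul_eq_mul]; ring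

end Sampling

/-! ### Nearly regular graphs: sampling and deletion -/

section NearRegular

open scoped Classical

variable {α β : Type*} {r : α → β → Prop}

theorem sum_sampleWeight_prod (p : ℝ) {A T : Finset α} {B U : Finset β} (hT : T ⊆ A) (hU : U ⊆ B) :
    ∑ x ∈ A.powerset ×ˢ B.powerset, sampleWeight p A x.1 * sampleWeight p B x.2 *
      (subsetInd T x.1 * subsetInd U x.2) = p ^ #T * p ^ #U := by
  rw [← sum_sampleWeight_mul_subsetInd p hT, ← sum_sampleWeight_mul_subsetInd p hU, sum_mul_sum,
    sum_product]
  exact sum_congr rfl fun _ _ => sum_congr rfl fun _ _ => by ring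

theorem sum_sampleWeight_prod_left (p : ℝ) {A T : Finset α} (B : Finset β) (hT : T ⊆ A) :
    ∑ x ∈ A.powerset ×ˢ B.powerset, sampleWeight p A x.1 * sampleWeight p B x.2 *
      subsetInd T x.1 = p ^ #T := by
  simpa [subsetInd_of_subset] using sum_sampleWeight_prod p hT (empty_subset B)

theorem sum_sampleWeight_prod_right (p : ℝ) (A : Finset α) {B U : Finset β} (hU : U ⊆ B) :
    ∑ x ∈ A.powerset ×ˢ B.powerset, sampleWeight p A x.1 * sampleWeight p B x.2 *
      subsetInd U x.2 = p ^ #U := by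
  simpa [subsetInd_of_subset] using sum_sampleWeight_prod p (empty_subset A) hU

theorem sum_subsetInd_singleton {A S : Finset α} (h : S ⊆ A) :
    ∑ a ∈ A, subsetInd {a} S = #S := by
  rw [← card_inter_eq_sum_subsetInd, inter_eq_right.2 h]

/-- The number of pairs consisting of a four-cycle through `a` in the sample `(R, S)` and an edge
at `a` in the sample. -/
noncomputable def fourCyclePenalty (r : α → β → Prop) (A : Finset α) (B : Finset β) (a : α)
    (R : Finset α) (S : Finset β) : ℝ :=
  ∑ a' ∈ A.erase a, ∑ q ∈ (relNbrs r B a ∩ relNbrs r B a').offDiag, ∑ b ∈ relNbrs r B a,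
    subsetInd {a, a'} R * subsetInd {q.1, q.2, b} S

theorem fourCyclePenalty_nonneg (A : Finset α) (B : Finset β) (a : α) (R : Finset α)
    (S : Finset β) : 0 ≤ fourCyclePenalty r A B a R S :=
  sum_nonneg fun _ _ => sum_nonneg fun _ _ => sum_nonneg fun _ _ =>
    mul_nonneg (subsetInd_nonneg _ _) (subsetInd_nonneg _ _)

theorem card_relNbrs_le_fourCyclePenalty {A R : Finset α} {B S : Finset β} {a a' : α} (hR : R ⊆ A)
    (hS : S ⊆ B) (ha : a ∈ R) (ha' : a' ∈ R) (hne : a ≠ a')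
    (h : 1 < #(relNbrs r S a ∩ relNbrs r S a')) :
    (#(relNbrs r S a) : ℝ) ≤ fourCyclePenalty r A B a R S := by
  obtain ⟨b, hb, b', hb', hbb⟩ := one_lt_card.1 h
  have hmem : ∀ c ∈ relNbrs r S a ∩ relNbrs r S a', c ∈ S ∧ c ∈ relNbrs r B a ∩ relNbrs r B a' :=
    fun c hc => ⟨relNbrs_subset _ _ _ (mem_inter.1 hc).1,
      inter_subset_inter (relNbrs_mono hS a) (relNbrs_mono hS a') hc⟩
  have hq : (b, b') ∈ (relNbrs r B a ∩ relNbrs r B a').offDiag :=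
    mem_offDiag.2 ⟨(hmem b hb).2, (hmem b' hb').2, hbb⟩
  let g : α → β × β → β → ℝ := fun x q c => subsetInd {a, x} R * subsetInd {q.1, q.2, c} S
  have hg : ∀ x q c, 0 ≤ g x q c := fun _ _ _ =>
    mul_nonneg (subsetInd_nonneg _ _) (subsetInd_nonneg _ _)
  have hone : ∀ c ∈ relNbrs r S a, g a' (b, b') c = 1 := by
    intro c hc
    simp only [g]
    rw [subsetInd_of_subset, subsetInd_of_subset, one_mul]
    · exact insert_subset (hmem b hb).1 (insert_subset (hmem b' hb').1
        (singleton_subset_iff.2 (relNbrs_subset _ _ _ hc)))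
    · exact insert_subset ha (singleton_subset_iff.2 ha')
  have h1 : (#(relNbrs r S a) : ℝ) ≤ ∑ c ∈ relNbrs r B a, g a' (b, b') c := by
    refine le_trans (le_of_eq ?_) (sum_le_sum_of_subset_of_nonneg (relNbrs_mono hS a)
      fun c _ _ => hg a' (b, b') c)
    rw [sum_congr rfl hone]; simp
  have h2 := single_le_sum (f := fun q => ∑ c ∈ relNbrs r B a, g a' q c)
    (fun q _ => sum_nonneg fun c _ => hg a' q c) hq
  have h3 := single_le_sum (s := A.erase a)
    (f := fun x => ∑ q ∈ (relNbrs r B a ∩ relNbrs r B x).offDiag, ∑ c ∈ relNbrs r B a, g x q c)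
    (fun x _ => sum_nonneg fun q _ => sum_nonneg fun c _ => hg x q c)
    (mem_erase.2 ⟨hne.symm, hR ha'⟩)
  exact h1.trans (h2.trans h3)

/-- Deleting all vertices of `R` that lie in a four-cycle. -/
theorem hasDenseLinear_of_penalty_lt {t : ℕ} {A R : Finset α} {B S : Finset β} (hR : R ⊆ A)
    (hS : S ⊆ B)
    (h : (t : ℝ) * (#R + #S) + 2 * ∑ a ∈ A, fourCyclePenalty r A B a R S <
      2 * ∑ a ∈ R, (#(relNbrs r S a) : ℝ)) :
    HasDenseLinear r t A B := by
  let bad : α → Prop := fun a => ∃ a' ∈ R, a ≠ a' ∧ 1 < #(relNbrs r S a ∩ relNbrs r S a')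
  have hsplit : ∑ a ∈ R with bad a, (#(relNbrs r S a) : ℝ) +
      ∑ a ∈ R with ¬ bad a, (#(relNbrs r S a) : ℝ) = ∑ a ∈ R, (#(relNbrs r S a) : ℝ) :=
    sum_filter_add_sum_filter_not _ _ _
  have hlost : ∑ a ∈ R with bad a, (#(relNbrs r S a) : ℝ) ≤
      ∑ a ∈ A, fourCyclePenalty r A B a R S := by
    refine (sum_le_sum fun a ha => ?_).trans (sum_le_sum_of_subset_of_nonneg
      ((filter_subset bad R).trans hR) fun _ _ _ => fourCyclePenalty_nonneg _ _ _ _ _)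
    obtain ⟨h1, a', h2, h3, h4⟩ := mem_filter.1 ha
    exact card_relNbrs_le_fourCyclePenalty hR hS h1 h2 h3 h4
  have hcard : (#{a ∈ R | ¬ bad a} : ℝ) ≤ #R := by exact_mod_cast card_filter_le _ _
  have hfinal : (t : ℝ) * (#{a ∈ R | ¬ bad a} + #S) <
      2 * ∑ a ∈ R with ¬ bad a, (#(relNbrs r S a) : ℝ) := by
    have := mul_le_mul_of_nonneg_left hcard (Nat.cast_nonneg (α := ℝ) t)
    nlinarith
  have hnat : t * (#{a ∈ R | ¬ bad a} + #S) < 2 * ∑ a ∈ R with ¬ bad a, #(relNbrs r S a) := by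
    exact_mod_cast hfinal
  refine ⟨{a ∈ R | ¬ bad a}, (filter_subset _ _).trans hR, S, hS, ?_, ?_, hnat.le⟩
  · rw [nonempty_iff_ne_empty]
    intro h0
    rw [h0, sum_empty] at hnat
    omega
  · intro a ha a' ha' hne
    by_contra! hcon
    exact (mem_filter.1 ha).2 ⟨a', (mem_filter.1 ha').1, hne, hcon⟩

/-- The two choices `c = b` and `c = b'` cost `p ^ 2` each and every other `c` costs `p ^ 3`. -/
theorem sum_pow_card_insert_insert_le {p K : ℝ} (hp : 0 ≤ p) {N : Finset β} (hK : p * #N ≤ K)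
    {b b' : β} (hne : b ≠ b') :
    ∑ c ∈ N, p ^ #({b, b', c} : Finset β) ≤ (2 + K) * p ^ 2 := by
  have h1 : ∀ c ∈ N, p ^ #({b, b', c} : Finset β) ≤
      (if c = b then p ^ 2 else 0) + (if c = b' then p ^ 2 else 0) + p ^ 3 := by
    intro c _
    have hp2 : 0 ≤ p ^ 2 := by positivity
    have hp3 : 0 ≤ p ^ 3 := by positivity
    by_cases hcb : c = b
    · have : ({b, b', c} : Finset β) = {b, b'} := by ext x; simp [hcb]; tauto
      rw [this, card_pair hne, if_pos hcb]
      split_ifs <;> linarith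
    · by_cases hcb' : c = b'
      · have : ({b, b', c} : Finset β) = {b, b'} := by ext x; simp [hcb']
        rw [this, card_pair hne, if_neg hcb, if_pos hcb']
        linarith
      · have : #({b, b', c} : Finset β) = 3 :=
          card_eq_three.2 ⟨b, b', c, hne, Ne.symm hcb, Ne.symm hcb', rfl⟩
        rw [this, if_neg hcb, if_neg hcb']
        linarith
  have h2 : ∀ x : β, ∑ c ∈ N, (if c = x then p ^ 2 else 0) ≤ p ^ 2 := by
    intro x
    rw [sum_ite_eq']
    split_ifs
    · exact le_rfl
    · positivity
  calc _ ≤ ∑ c ∈ N, ((if c = b then p ^ 2 else 0) + (if c = b' then p ^ 2 else 0) + p ^ 3) :=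
        sum_le_sum h1
    _ ≤ p ^ 2 + p ^ 2 + #N * p ^ 3 := by
        rw [sum_add_distrib, sum_add_distrib, sum_const, nsmul_eq_mul]
        gcongr <;> exact h2 _
    _ = (2 + p * #N) * p ^ 2 := by ring
    _ ≤ _ := by gcongr

theorem sum_sampleWeight_fourCyclePenalty_le {p K : ℝ} (hp : 0 ≤ p) (hK0 : 0 ≤ K) {A : Finset α}
    {B : Finset β} (hK : ∀ a ∈ A, p * #(relNbrs r B a) ≤ K) :
    ∑ x ∈ A.powerset ×ˢ B.powerset, sampleWeight p A x.1 * sampleWeight p B x.2 *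
      ∑ a ∈ A, fourCyclePenalty r A B a x.1 x.2 ≤
    (2 + K) * p ^ 4 * ∑ a ∈ A, ∑ a' ∈ A, (#(relNbrs r B a ∩ relNbrs r B a') : ℝ) ^ 2 := by
  simp only [fourCyclePenalty, mul_sum]
  rw [sum_comm]
  refine sum_le_sum fun a ha => ?_
  rw [sum_comm]
  refine (sum_le_sum fun a' ha' => ?_).trans (sum_le_sum_of_subset_of_nonneg (erase_subset a A)
    fun _ _ _ => by positivity)
  obtain ⟨hne, ha'⟩ := mem_erase.1 ha'
  rw [sum_comm]
  have hq : ∀ q ∈ (relNbrs r B a ∩ relNbrs r B a').offDiag,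
      ∑ x ∈ A.powerset ×ˢ B.powerset, ∑ c ∈ relNbrs r B a,
        sampleWeight p A x.1 * sampleWeight p B x.2 *
          (subsetInd {a, a'} x.1 * subsetInd {q.1, q.2, c} x.2) ≤ (2 + K) * p ^ 4 := by
    intro q hq
    obtain ⟨h1, h2, h3⟩ := mem_offDiag.1 hq
    have hB : ∀ b ∈ relNbrs r B a ∩ relNbrs r B a', b ∈ B := fun b hb =>
      relNbrs_subset _ _ _ (mem_inter.1 hb).1
    rw [sum_comm]
    rw [sum_congr rfl fun c hc => sum_sampleWeight_prod p (T := {a, a'}) (U := {q.1, q.2, c})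
      (insert_subset ha (singleton_subset_iff.2 ha')) (insert_subset (hB _ h1)
        (insert_subset (hB _ h2) (singleton_subset_iff.2 (relNbrs_subset _ _ _ hc)))),
      ← mul_sum, card_pair hne.symm]
    calc _ ≤ p ^ 2 * ((2 + K) * p ^ 2) := by
          gcongr
          exact sum_pow_card_insert_insert_le hp (hK a ha) h3
      _ = _ := by ring
  refine (sum_le_card_nsmul _ _ _ hq).trans ?_
  rw [nsmul_eq_mul, mul_comm]
  gcongr
  rw [offDiag_card, sq]
  exact_mod_cast Nat.sub_le _ _

/-- Balanced, nearly regular biclique-free bipartite graphs contain dense induced `C₄`-free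
subgraphs. -/
theorem exists_hasDenseLinear_of_nearRegular {t C : ℕ} (ht : 1 ≤ t) (hC : 1 ≤ C) : ∃ D₀ : ℕ,
    ∀ D ≥ D₀, ∀ {α β : Type*} {r : α → β → Prop}, BicliqueFree r t →
      ∀ (A : Finset α) (B : Finset β), A.Nonempty → (∀ a ∈ A, D ≤ #(relNbrs r B a)) →
        (∀ a ∈ A, #(relNbrs r B a) ≤ C * D) → (∀ b ∈ B, #{a ∈ A | r a b} ≤ C * D) →
        #B ≤ 4 * #A → HasDenseLinear r t A B := by
  -- Chosen so that the penalty bound `(2 + 10 * t * C) * p ^ 4 * Q` is at most `#A / D`, hence at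
  -- most `p * #A`; here `20000 = 2 * 10 ^ 4`.
  let q := 20000 * C ^ 3 * t ^ 4 * (2 + 10 * t * C)
  have hq : 0 < q := by positivity
  obtain ⟨m₀, hm₀⟩ := exists_sum_sq_codegree_le t q hq
  refine ⟨max (10 * t + 1) m₀, fun D hD {α β r} hr A B hA hlow hup hupB hBA => ?_⟩
  have hD1 : 10 * t < D := (le_max_left _ _).trans hD
  have hD2 : m₀ ≤ C * D := ((le_max_right _ _).trans hD).trans (Nat.le_mul_of_pos_left D hC)
  have hQ := hm₀ hr (C * D) hD2 A B hup hupB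
  have ht' : (1 : ℝ) ≤ t := by exact_mod_cast ht
  have hD' : 10 * (t : ℝ) < D := by exact_mod_cast hD1
  have hD0 : (0 : ℝ) < D := by linarith
  have hn : (0 : ℝ) < #A := by exact_mod_cast hA.card_pos
  have hBA' : (#B : ℝ) ≤ 4 * #A := by exact_mod_cast hBA
  set p : ℝ := 10 * t / D with hp
  have hp0 : 0 < p := by positivity
  have hp1 : p < 1 := by rw [hp, div_lt_one hD0]; exact hD'
  have hpD : p * D = 10 * t := by rw [hp]; field_simp
  set Q : ℝ := ∑ a ∈ A, ∑ a' ∈ A, (#(relNbrs r B a ∩ relNbrs r B a') : ℝ) ^ 2 with hQdef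
  have hQ' : (q : ℝ) * Q ≤ 2 * #A * (C * D) ^ 3 := by rw [hQdef]; exact_mod_cast hQ
  have hpen := sum_sampleWeight_fourCyclePenalty_le (r := r) (p := p) (K := 10 * t * C) hp0.le
    (by positivity) (A := A) (B := B) fun a ha => by
      have h1 : (#(relNbrs r B a) : ℝ) ≤ C * D := by exact_mod_cast hup a ha
      calc p * #(relNbrs r B a) ≤ p * (C * D) := by gcongr
        _ = (p * D) * C := by ring
        _ = _ := by rw [hpD]
  have hpen' : (2 + 10 * (t : ℝ) * C) * p ^ 4 * Q ≤ p * #A := by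
    have hqR : (q : ℝ) = 20000 * C ^ 3 * t ^ 4 * (2 + 10 * t * C) := by simp [q]
    rw [hqR] at hQ'
    have hCR : (0 : ℝ) < C := by exact_mod_cast hC
    have h1 : (2 + 10 * (t : ℝ) * C) * 10000 * t ^ 4 * Q ≤ #A * D ^ 3 := by
      have hc : (0 : ℝ) < 2 * C ^ 3 := by positivity
      refine le_of_mul_le_mul_left ?_ hc
      calc _ = 20000 * (C : ℝ) ^ 3 * t ^ 4 * (2 + 10 * t * C) * Q := by ring
        _ ≤ _ := hQ'
        _ = _ := by ring
    have h2 : p ^ 4 * D ^ 4 = 10000 * t ^ 4 := by rw [← mul_pow, hpD]; ring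
    have hD3 : (0 : ℝ) < D ^ 4 := by positivity
    refine le_of_mul_le_mul_right ?_ hD3
    calc (2 + 10 * (t : ℝ) * C) * p ^ 4 * Q * D ^ 4
        = (2 + 10 * (t : ℝ) * C) * (p ^ 4 * D ^ 4) * Q := by ring
      _ = (2 + 10 * (t : ℝ) * C) * 10000 * t ^ 4 * Q := by rw [h2]; ring
      _ ≤ #A * D ^ 3 := h1
      _ ≤ (10 * t) * (#A * D ^ 3) := le_mul_of_one_le_left (by positivity) (by linarith)
      _ = (p * D) * (#A * D ^ 3) := by rw [hpD]
      _ = _ := by ring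
  let w : Finset α × Finset β → ℝ := fun x => sampleWeight p A x.1 * sampleWeight p B x.2
  let edges : Finset α × Finset β → ℝ := fun x =>
    ∑ a ∈ A, ∑ b ∈ relNbrs r B a, subsetInd {a} x.1 * subsetInd {b} x.2
  let F : Finset α × Finset β → ℝ := fun x =>
    t * (∑ a ∈ A, subsetInd {a} x.1 + ∑ b ∈ B, subsetInd {b} x.2) +
      2 * ∑ a ∈ A, fourCyclePenalty r A B a x.1 x.2 - 2 * edges x
  have hEA : ∑ x ∈ A.powerset ×ˢ B.powerset, w x * ∑ a ∈ A, subsetInd {a} x.1 = #A * p := by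
    simp only [mul_sum]
    rw [sum_comm, sum_congr rfl fun a ha =>
      sum_sampleWeight_prod_left p B (singleton_subset_iff.2 ha)]
    simp
  have hEB : ∑ x ∈ A.powerset ×ˢ B.powerset, w x * ∑ b ∈ B, subsetInd {b} x.2 = #B * p := by
    simp only [mul_sum]
    rw [sum_comm, sum_congr rfl fun b hb =>
      sum_sampleWeight_prod_right p A (singleton_subset_iff.2 hb)]
    simp
  have hEe : #A * (D * p ^ 2) ≤ ∑ x ∈ A.powerset ×ˢ B.powerset, w x * edges x := by
    simp only [edges, mul_sum]
    rw [sum_comm, ← nsmul_eq_mul]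
    refine card_nsmul_le_sum _ _ _ fun a ha => ?_
    rw [sum_comm, sum_congr rfl fun b hb => sum_sampleWeight_prod p (singleton_subset_iff.2 ha)
      (singleton_subset_iff.2 (relNbrs_subset _ _ _ hb))]
    have h1 : (D : ℝ) ≤ #(relNbrs r B a) := by exact_mod_cast hlow a ha
    simp only [card_singleton, pow_one, sum_const, nsmul_eq_mul, ← sq]
    gcongr
  have hF : ∑ x ∈ A.powerset ×ˢ B.powerset, w x * F x =
      t * (#A * p + #B * p) + 2 * ∑ x ∈ A.powerset ×ˢ B.powerset, w x *
        ∑ a ∈ A, fourCyclePenalty r A B a x.1 x.2 -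
      2 * ∑ x ∈ A.powerset ×ˢ B.powerset, w x * edges x := by
    rw [← hEA, ← hEB, mul_add, mul_sum, mul_sum, mul_sum, mul_sum, ← sum_add_distrib,
      ← sum_add_distrib, ← sum_sub_distrib]
    exact sum_congr rfl fun x _ => by simp only [F]; ring
  -- In units of `p * #A`, the vertices cost at most `5 * t`, the penalty at most 2, and twice the
  -- edges gain at least `20 * t`.
  have hneg : ∑ x ∈ A.powerset ×ˢ B.powerset, w x * F x ≤ -(p * #A) := by
    rw [hF]
    have h1 : #A * ((D : ℝ) * p ^ 2) = 10 * t * (p * #A) := by rw [← hpD]; ring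
    rw [h1] at hEe
    have h2 : (t : ℝ) * (#A * p + #B * p) ≤ 5 * t * (p * #A) := by
      have := mul_le_mul_of_nonneg_left hBA' (by positivity : 0 ≤ t * p)
      linarith
    have h3 : p * #A ≤ t * (p * #A) := le_mul_of_one_le_left (by positivity) ht'
    have h4 := hpen.trans hpen'
    change ∑ x ∈ A.powerset ×ˢ B.powerset, w x * ∑ a ∈ A, fourCyclePenalty r A B a x.1 x.2 ≤ _
      at h4
    have h5 : 0 ≤ t * (p * #A) := by positivity
    linarith
  obtain ⟨⟨R, S⟩, hRS, hle⟩ := exists_le_of_weighted_sum_le (w := w)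
    (fun x _ => mul_pos (sampleWeight_pos hp0 hp1 A x.1) (sampleWeight_pos hp0 hp1 B x.2))
    (by
      simp only [w]
      rw [sum_product, ← sum_mul_sum, sum_sampleWeight, sum_sampleWeight, one_mul]) hneg
  obtain ⟨hR, hS⟩ := mem_product.1 hRS
  have hR := mem_powerset.1 hR
  have hS := mem_powerset.1 hS
  refine hasDenseLinear_of_penalty_lt hR hS ?_
  have hedges : edges (R, S) = ∑ a ∈ R, (#(relNbrs r S a) : ℝ) := by
    simp only [edges, ← mul_sum, ← card_inter_eq_sum_subsetInd, ← relNbrs_eq_inter hS]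
    simp only [subsetInd, singleton_subset_iff, ite_mul, one_mul, zero_mul]
    rw [sum_ite_mem, inter_eq_right.2 hR]
  have hlt : F (R, S) < 0 := hle.trans_lt (neg_neg_of_pos (by positivity))
  simp only [F, hedges, sum_subsetInd_singleton hR, sum_subsetInd_singleton hS] at hlt
  linarith

end NearRegular

/-! ### Splitting `B` by degree -/

section Assembly

open scoped Classical

variable {α β : Type*} {r : α → β → Prop}

/-- Unbalanced biclique-free bipartite graphs of large minimum degree contain dense induced
`C₄`-free subgraphs; the imbalance needed does not depend on the degree. -/
theorem exists_hasDenseLinear_of_unbalanced (t : ℕ) : ∃ L D₀ : ℕ,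
    ∀ D ≥ D₀, ∀ {α β : Type*} {r : α → β → Prop}, BicliqueFree r t →
      ∀ (A : Finset α) (B : Finset β), A.Nonempty → (∀ a ∈ A, D ≤ #(relNbrs r B a)) →
        (∀ a ∈ A, #(relNbrs r B a) ≤ 24 * D) → L * #B ≤ #A → HasDenseLinear r t A B := by
  obtain ⟨k₀, hk₀⟩ := exists_ratio_hasDenseLinear t t
  let k := max k₀ 96
  -- The degrees after sampling lie in `[k, 49k]` with `k` depending on `t` only, which keeps `L`
  -- independent of `D`.
  obtain ⟨L, hL⟩ := hk₀ (49 * k) t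
  refine ⟨2 * L, 2 * k + 1, fun D hD {α β r} hr A B hA hlow hup hLA => ?_⟩
  obtain ⟨S, hSB, hS⟩ := exists_subset_degree_range (le_max_right k₀ 96) hD hlow hup
  let A₂ : Finset α := {a ∈ A | k ≤ #(relNbrs r S a) ∧ #(relNbrs r S a) ≤ 49 * k}
  change #A ≤ 2 * #A₂ at hS
  have hApos := hA.card_pos
  refine HasDenseLinear.mono (filter_subset _ _ : A₂ ⊆ A) hSB (hL r A₂ S ?_ ?_ ?_ ?_ ?_)
  · rw [← card_pos]; omega
  · exact fun a ha => (le_max_left k₀ 96).trans (mem_filter.1 ha).2.1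
  · exact fun a ha => (mem_filter.1 ha).2.2
  · exact fun T _ hT => (hr.card_relCommon_lt A₂ (by omega)).le
  · have := Nat.mul_le_mul_left L (card_le_card hSB)
    linarith

theorem exists_hasDenseLinear_of_degree_range {t : ℕ} (ht : 1 ≤ t) : ∃ D₀ : ℕ,
    ∀ D ≥ D₀, ∀ {α β : Type*} {r : α → β → Prop}, BicliqueFree r t →
      ∀ (A : Finset α) (B : Finset β), A.Nonempty → (∀ a ∈ A, 2 * D ≤ #(relNbrs r B a)) →
        (∀ a ∈ A, #(relNbrs r B a) ≤ 24 * D) → #B ≤ 2 * #A → HasDenseLinear r t A B := by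
  obtain ⟨L, D₁, h₁⟩ := exists_hasDenseLinear_of_unbalanced t
  -- Counting edges at `hi` gives `#hi * C * D ≤ 24 * D * #A`. The factor 48 is this 24 times 2 for
  -- passing to half of `A`.
  let C := 48 * L + 24
  obtain ⟨D₂, h₂⟩ := exists_hasDenseLinear_of_nearRegular ht (C := C) (by omega)
  refine ⟨max (max D₁ D₂) 1, fun D hD {α β r} hr A B hA hlow hup hBA => ?_⟩
  have hD₁ : D₁ ≤ D := (le_max_left _ _).trans ((le_max_left _ _).trans hD)
  have hD₂ : D₂ ≤ D := (le_max_right _ _).trans ((le_max_left _ _).trans hD)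
  have hD0 : 0 < D := (le_max_right _ _).trans hD
  have hApos := hA.card_pos
  let hi : Finset β := {b ∈ B | C * D < #{a ∈ A | r a b}}
  let lo : Finset β := {b ∈ B | ¬ C * D < #{a ∈ A | r a b}}
  have hhi : hi ⊆ B := filter_subset _ _
  have hlo : lo ⊆ B := filter_subset _ _
  have hdeg : ∀ a, #(relNbrs r B a) ≤ #(relNbrs r hi a) + #(relNbrs r lo a) := by
    intro a
    refine (card_le_card fun b hb => ?_).trans (card_union_le _ _)
    obtain ⟨h1, h2⟩ := mem_relNbrs.1 hb
    simp only [mem_union, mem_relNbrs, hi, lo, mem_filter]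
    tauto
  have hsplit : #{a ∈ A | D ≤ #(relNbrs r hi a)} + #{a ∈ A | ¬ D ≤ #(relNbrs r hi a)} = #A :=
    card_filter_add_card_filter_not _
  rcases le_total #{a ∈ A | ¬ D ≤ #(relNbrs r hi a)} #{a ∈ A | D ≤ #(relNbrs r hi a)} with h | h
  · refine HasDenseLinear.mono (filter_subset _ _) hhi (h₁ D hD₁ hr {a ∈ A | D ≤ #(relNbrs r hi a)} hi
      ?_ (fun a ha => (mem_filter.1 ha).2) (fun a ha => ?_) ?_)
    · rw [← card_pos]; omega
    · exact (card_le_card (relNbrs_mono hhi a)).trans (hup a (mem_filter.1 ha).1)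
    · have h3 := card_mul_le_of_forall_lt_card_relCommon (r := r) (Δ := C * D) (T := ∅) hhi hup
        fun b hb => by simpa [relCommon] using (mem_filter.1 hb).2.le
      have h4 : #(relCommon r A (∅ : Finset β)) ≤ #A := card_filter_le _ _
      refine Nat.le_of_mul_le_mul_left (c := 48 * D) ?_ (by omega)
      calc 48 * D * (L * #hi) = #hi * (48 * L * D) := by ring
        _ ≤ #hi * (C * D) := by gcongr; omega
        _ ≤ _ := h3
        _ ≤ #A * (24 * D) := by gcongr
        _ ≤ (2 * #{a ∈ A | D ≤ #(relNbrs r hi a)}) * (24 * D) := by gcongr; omega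
        _ = _ := by ring
  · refine HasDenseLinear.mono (filter_subset _ _) hlo (h₂ D hD₂ hr
      {a ∈ A | ¬ D ≤ #(relNbrs r hi a)} lo ?_ (fun a ha => ?_) (fun a ha => ?_) (fun b hb => ?_) ?_)
    · rw [← card_pos]; omega
    · obtain ⟨h3, h4⟩ := mem_filter.1 ha
      have := hdeg a
      have := hlow a h3
      omega
    · refine ((card_le_card (relNbrs_mono hlo a)).trans (hup a (mem_filter.1 ha).1)).trans ?_
      exact Nat.mul_le_mul_right _ (by omega)
    · exact (card_le_card (filter_subset_filter _ (filter_subset _ _))).trans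
        (not_lt.1 (mem_filter.1 hb).2)
    · have := card_le_card hlo
      omega

end Assembly

/-! ### Back to graphs: minimum degree, girth and average degree -/

section Graph

open scoped Classical

variable {V : Type*} {G : SimpleGraph V}

theorem sum_card_relNbrs_comm {α β : Type*} (r : α → β → Prop) (A : Finset α) (B : Finset β) :
    ∑ a ∈ A, #(relNbrs r B a) = ∑ b ∈ B, #{a ∈ A | r a b} := by
  simp only [relNbrs, card_filter]; exact sum_comm

theorem sum_card_relNbrs_erase (G : SimpleGraph V) {W : Finset V} {v : V} (hv : v ∈ W) :
    ∑ u ∈ W, #(relNbrs G.Adj W u) =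
      ∑ u ∈ W.erase v, #(relNbrs G.Adj (W.erase v) u) + 2 * #(relNbrs G.Adj W v) := by
  have h1 : ∀ u ∈ W.erase v, #(relNbrs G.Adj W u) =
      #(relNbrs G.Adj (W.erase v) u) + if G.Adj u v then 1 else 0 := by
    intro u _
    have : relNbrs G.Adj (W.erase v) u = (relNbrs G.Adj W u).erase v := by
      simp only [relNbrs, filter_erase]
    rw [this]
    split_ifs with h
    · exact (card_erase_add_one (mem_relNbrs.2 ⟨hv, h⟩)).symm
    · rw [erase_eq_of_notMem fun h' => h (mem_relNbrs.1 h').2, add_zero]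
  have h2 : #{u ∈ W.erase v | G.Adj u v} = #(relNbrs G.Adj W v) := by
    congr 1
    ext u
    simp only [mem_filter, mem_erase, mem_relNbrs]
    exact ⟨fun h => ⟨h.1.2, h.2.symm⟩, fun h => ⟨⟨h.2.ne', h.1⟩, h.2.symm⟩⟩
  rw [← add_sum_erase _ _ hv, sum_congr rfl h1, sum_add_distrib, ← card_filter, h2]
  ring

/-- A graph of large average degree has an induced subgraph of large minimum degree whose average
degree is not much larger. -/
theorem exists_minDegree_lt_and_sum_le {D : ℕ} (hD : 1 ≤ D) {U : Finset V} (hU : U.Nonempty)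
    (h : 4 * D * #U ≤ ∑ v ∈ U, #(relNbrs G.Adj U v)) :
    ∃ W : Finset V, W.Nonempty ∧ (∀ v ∈ W, 2 * D < #(relNbrs G.Adj W v)) ∧
      ∑ v ∈ W, #(relNbrs G.Adj W v) ≤ 6 * D * #W := by
  let P : Finset V → Prop := fun W => W.Nonempty ∧ 4 * D * #W ≤ ∑ v ∈ W, #(relNbrs G.Adj W v)
  obtain ⟨W, -, ⟨hW, hWe⟩, hmin⟩ : ∃ W ≤ U, Minimal P W :=
    exists_minimal_le_of_wellFoundedLT P U ⟨hU, h⟩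
  -- Deleting `v` must push the average below `4 * D`. Since `W` itself reaches it, `v` has degree
  -- above `2 * D`; since `v` has degree at most `#W`, the average on `W` is below `4 * D + 2`.
  have hkey : ∀ v ∈ W, ∑ u ∈ W, #(relNbrs G.Adj W u) + 4 * D <
      4 * D * #W + 2 * #(relNbrs G.Adj W v) := by
    intro v hv
    have h1 := sum_card_relNbrs_erase G hv
    have hcard := card_erase_add_one hv
    have hne : (W.erase v).Nonempty := by
      by_contra hemp
      rw [not_nonempty_iff_eq_empty] at hemp
      have hWv : W = {v} := by rw [← insert_erase hv, hemp]; rfl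
      have : relNbrs G.Adj W v = ∅ := by
        rw [hWv]; ext u; simp only [mem_relNbrs, mem_singleton, notMem_empty, iff_false]
        rintro ⟨rfl, h⟩; exact G.irrefl h
      rw [hemp, this] at h1
      rw [h1, ← hcard, hemp] at hWe
      simp at hWe
      omega
    have hlt : ∑ u ∈ W.erase v, #(relNbrs G.Adj (W.erase v) u) < 4 * D * #(W.erase v) := by
      by_contra! hcon
      exact notMem_erase v W (hmin ⟨hne, hcon⟩ (erase_subset v W) hv)
    rw [h1, ← hcard]
    linarith
  refine ⟨W, hW, fun v hv => ?_, ?_⟩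
  · have := hkey v hv
    omega
  · obtain ⟨v, hv⟩ := hW
    have h1 := hkey v hv
    have h2 : #(relNbrs G.Adj W v) ≤ #W := card_le_card (relNbrs_subset _ _ _)
    nlinarith

theorem bicliqueFree_of_not_isContained {t : ℕ}
    (h : ¬ (completeBipartiteGraph (Fin t) (Fin t)).IsContained G) : BicliqueFree G.Adj t := by
  intro X Y hX hY hXY
  apply h
  let e := (X.equivFinOfCardEq hX).symm
  let e' := (Y.equivFinOfCardEq hY).symm
  have hadj : ∀ i j, G.Adj (e i) (e' j) := fun i j => hXY _ (e i).2 _ (e' j).2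
  refine ⟨⟨⟨Sum.elim (fun i => (e i : V)) (fun j => (e' j : V)), ?_⟩, ?_⟩⟩
  · rintro (i | i) (j | j) hij
    · simp at hij
    · exact hadj i j
    · exact (hadj j i).symm
    · simp at hij
  · rintro (i | i) (j | j) hij
    · exact congrArg Sum.inl (e.injective (Subtype.ext hij))
    · exact absurd hij (hadj i j).ne
    · exact absurd hij (hadj j i).ne'
    · exact congrArg Sum.inr (e'.injective (Subtype.ext hij))

theorem SimpleGraph.averageDegree_induce (G : SimpleGraph V) (S : Finset V) :
    (G.induce (S : Set V)).averageDegree = (∑ v ∈ S, (#(relNbrs G.Adj S v) : ℚ)) / #S := by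
  have h : ∀ v : (S : Set V), (G.induce (S : Set V)).degree v = #(relNbrs G.Adj S v) := by
    intro v
    rw [← SimpleGraph.card_neighborFinset_eq_degree]
    refine card_bij (fun u _ => (u : V)) ?_ ?_ ?_
    · intro u hu
      rw [SimpleGraph.mem_neighborFinset] at hu
      exact mem_relNbrs.2 ⟨u.2, hu⟩
    · exact fun u _ u' _ h => Subtype.ext h
    · intro u hu
      obtain ⟨h1, h2⟩ := mem_relNbrs.1 hu
      exact ⟨⟨u, h1⟩, by rw [SimpleGraph.mem_neighborFinset]; exact h2, rfl⟩
  unfold SimpleGraph.averageDegree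
  congr 1
  · rw [← Finset.sum_coe_sort S]
    refine Finset.sum_congr rfl fun v _ => ?_
    rw [← h v]
    congr!
  · simp

/-- A bipartite graph in which no two vertices of one side have two common neighbours has girth at
least six. -/
theorem six_le_egirth_induce {A B : Finset V} (c : G.Coloring Bool)
    (hA : ∀ v ∈ A, c v = true) (hB : ∀ v ∈ B, c v = false)
    (h : ∀ a ∈ A, ∀ a' ∈ A, a ≠ a' → #(relNbrs G.Adj B a ∩ relNbrs G.Adj B a') ≤ 1) :
    6 ≤ (G.induce ((A ∪ B : Finset V) : Set V)).egirth := by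
  have hpair : ∀ a ∈ A ∪ B, ∀ a' ∈ A ∪ B, ∀ b ∈ A ∪ B, ∀ b' ∈ A ∪ B, c a = true → a ≠ a' → b ≠ b' →
      G.Adj a b → G.Adj a b' → G.Adj a' b → G.Adj a' b' → False := by
    intro a ha a' ha' b hb b' hb' hca hne hne' h1 h2 h3 h4
    have memA : ∀ v ∈ A ∪ B, c v = true → v ∈ A := fun v hv hc => by
      rcases mem_union.1 hv with h | h
      · exact h
      · rw [hB v h] at hc; simp at hc
    have memB : ∀ v ∈ A ∪ B, c v = false → v ∈ B := fun v hv hc => by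
      rcases mem_union.1 hv with h | h
      · rw [hA v h] at hc; simp at hc
      · exact h
    have hcb : c b = false := by have := c.valid h1; rw [hca] at this; simpa using this.symm
    have hcb' : c b' = false := by have := c.valid h2; rw [hca] at this; simpa using this.symm
    have hca' : c a' = true := by have := c.valid h3; rw [hcb] at this; simpa using this
    have hle := h a (memA a ha hca) a' (memA a' ha' hca') hne
    have hbB := memB b hb hcb
    have hbB' := memB b' hb' hcb'
    refine absurd (one_lt_card.2 ⟨b, ?_, b', ?_, hne'⟩) (not_lt.2 hle) <;>
      simp [mem_relNbrs, *]
  rw [SimpleGraph.le_egirth]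
  intro x w hw
  -- Cycles are even by the colouring, so only length 4 remains to be excluded.
  have h3 := hw.three_le_length
  have heven : Even w.length := by
    have c' : (G.induce ((A ∪ B : Finset V) : Set V)).Coloring Bool :=
      c.comp (SimpleGraph.Embedding.induce _).toHom
    exact (c'.even_length_iff_congr w).2 Iff.rfl
  have h4 : w.length ≠ 4 := by
    intro hlen
    match w, hw, hlen with
    | .cons (v := y) hxy (.cons (v := z) hyz (.cons (v := u) hzu (.cons hux .nil))), hw, _ =>
      have hnd := hw.support_nodup
      simp only [SimpleGraph.Walk.support_cons, SimpleGraph.Walk.support_nil, List.tail_cons,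
        List.nodup_cons, List.mem_cons, List.not_mem_nil, or_false, not_or] at hnd
      have hyu : (y : V) ≠ u := fun h => hnd.1.2.1 (Subtype.ext h)
      have hxz : (x : V) ≠ z := fun h => hnd.2.1.2 (Subtype.ext h.symm)
      have hxy : G.Adj x y := hxy
      have hyz : G.Adj y z := hyz
      have hzu : G.Adj z u := hzu
      have hux : G.Adj u x := hux
      cases hc : c (x : V) with
      | true => exact hpair x x.2 z z.2 y y.2 u u.2 hc hxz hyu hxy hux.symm hyz.symm hzu
      | false =>
        have hcy : c (y : V) = true := by
          have := c.valid hxy; rw [hc] at this; simpa using this.symm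
        exact hpair y y.2 u u.2 x x.2 z z.2 hcy hyu hxz hxy.symm hyz hux hzu.symm
  have h6 : 6 ≤ w.length := by
    obtain ⟨m, hm⟩ := heven
    omega
  exact_mod_cast h6

theorem exists_induce_of_hasDenseLinear {t : ℕ} {A B : Finset V} (c : G.Coloring Bool)
    (hA : ∀ v ∈ A, c v = true) (hB : ∀ v ∈ B, c v = false) (h : HasDenseLinear G.Adj t A B) :
    ∃ S : Finset V, S.Nonempty ∧ (t : ℚ) ≤ (G.induce (S : Set V)).averageDegree ∧
      6 ≤ (G.induce (S : Set V)).egirth := by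
  obtain ⟨A', hA', B', hB', hne, hlin, hdense⟩ := h
  have hdisj : Disjoint A' B' := by
    rw [disjoint_left]
    intro v h1 h2
    have := hA v (hA' h1)
    rw [hB v (hB' h2)] at this
    simp at this
  refine ⟨A' ∪ B', hne.mono subset_union_left, ?_, six_le_egirth_induce c (fun v hv => hA v (hA' hv))
    (fun v hv => hB v (hB' hv)) hlin⟩
  have hsum : t * #(A' ∪ B') ≤ ∑ v ∈ A' ∪ B', #(relNbrs G.Adj (A' ∪ B') v) := by
    rw [card_union_of_disjoint hdisj, sum_union hdisj]
    have h1 : ∑ v ∈ A', #(relNbrs G.Adj B' v) ≤ ∑ v ∈ A', #(relNbrs G.Adj (A' ∪ B') v) :=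
      sum_le_sum fun v _ => card_le_card (relNbrs_mono subset_union_right v)
    have h2 : ∑ v ∈ A', #(relNbrs G.Adj B' v) ≤ ∑ v ∈ B', #(relNbrs G.Adj (A' ∪ B') v) := by
      rw [sum_card_relNbrs_comm]
      refine sum_le_sum fun v _ => card_le_card fun u hu => ?_
      obtain ⟨h3, h4⟩ := mem_filter.1 hu
      exact mem_relNbrs.2 ⟨mem_union_left _ h3, h4.symm⟩
    omega
  rw [SimpleGraph.averageDegree_induce, le_div_iff₀]
  · exact_mod_cast hsum
  · exact_mod_cast (hne.mono subset_union_left).card_pos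

/-- By Markov's inequality at most a quarter of `W` has degree above `24 * D`, which is at most half
of the larger colour class. -/
theorem exists_induce_of_minDegree {t D : ℕ}
    (hD : ∀ {r : V → V → Prop}, BicliqueFree r t →
      ∀ (A : Finset V) (B : Finset V), A.Nonempty → (∀ a ∈ A, 2 * D ≤ #(relNbrs r B a)) →
        (∀ a ∈ A, #(relNbrs r B a) ≤ 24 * D) → #B ≤ 2 * #A → HasDenseLinear r t A B)
    (hD1 : 1 ≤ D) (hG : BicliqueFree G.Adj t) (c : G.Coloring Bool) {W : Finset V}
    (hW : W.Nonempty) (hlow : ∀ v ∈ W, 2 * D < #(relNbrs G.Adj W v))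
    (hsum : ∑ v ∈ W, #(relNbrs G.Adj W v) ≤ 6 * D * #W)
    (hbig : #{v ∈ W | ¬ c v = true} ≤ #{v ∈ W | c v = true}) :
    ∃ S : Finset V, S.Nonempty ∧ (t : ℚ) ≤ (G.induce (S : Set V)).averageDegree ∧
      6 ≤ (G.induce (S : Set V)).egirth := by
  let A : Finset V := {v ∈ W | c v = true}
  let B : Finset V := {v ∈ W | ¬ c v = true}
  have hcard : #A + #B = #W := card_filter_add_card_filter_not _
  change #B ≤ #A at hbig
  have hWpos := hW.card_pos
  have hnb : ∀ a ∈ A, relNbrs G.Adj B a = relNbrs G.Adj W a := by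
    intro a ha
    ext b
    simp only [mem_relNbrs, B, mem_filter]
    refine ⟨fun h => ⟨h.1.1, h.2⟩, fun h => ⟨⟨h.1, fun hb => ?_⟩, h.2⟩⟩
    exact c.valid h.2 ((mem_filter.1 ha).2.trans hb.symm)
  have hsplit : #{a ∈ A | #(relNbrs G.Adj B a) ≤ 24 * D} +
      #{a ∈ A | ¬ #(relNbrs G.Adj B a) ≤ 24 * D} = #A := card_filter_add_card_filter_not _
  have hbad : 2 * #{a ∈ A | ¬ #(relNbrs G.Adj B a) ≤ 24 * D} ≤ #A := by
    have h1 : #{a ∈ A | ¬ #(relNbrs G.Adj B a) ≤ 24 * D} * (24 * D) ≤ 6 * D * #W := by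
      refine le_trans ?_ hsum
      rw [← smul_eq_mul]
      refine (card_nsmul_le_sum _ (fun v => #(relNbrs G.Adj W v)) _ fun a ha => ?_).trans
        (sum_le_sum_of_subset ((filter_subset _ _).trans (filter_subset _ _)))
      obtain ⟨h2, h3⟩ := mem_filter.1 ha
      rw [hnb a h2] at h3
      exact (not_le.1 h3).le
    refine Nat.le_of_mul_le_mul_left (c := 12 * D) ?_ (by omega)
    calc _ = #{a ∈ A | ¬ #(relNbrs G.Adj B a) ≤ 24 * D} * (24 * D) := by ring
      _ ≤ 6 * D * #W := h1
      _ ≤ 6 * D * (2 * #A) := by gcongr; omega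
      _ = _ := by ring
  refine exists_induce_of_hasDenseLinear c (A := A) (B := B) (fun v hv => (mem_filter.1 hv).2)
    (fun v hv => by simpa using (mem_filter.1 hv).2) ?_
  refine HasDenseLinear.mono (filter_subset _ _) subset_rfl
    (hD hG {a ∈ A | #(relNbrs G.Adj B a) ≤ 24 * D} B ?_ (fun a ha => ?_)
      (fun a ha => (mem_filter.1 ha).2) ?_)
  · rw [← card_pos]; omega
  · obtain ⟨h1, _⟩ := mem_filter.1 ha
    rw [hnb a h1]
    exact (hlow a (mem_filter.1 h1).1).le
  · omega

end Graph

theorem theorem1 :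
    ∃ f : ℕ → ℕ, ∀ (t : ℕ) (V : Type*) [Fintype V] (G : SimpleGraph V),
      G.IsBipartite → (f t : ℚ) ≤ G.averageDegree →
        (completeBipartiteGraph (Fin t) (Fin t)).IsContained G ∨
        ∃ S : Finset V, S.Nonempty ∧
          (t : ℚ) ≤ (G.induce (S : Set V)).averageDegree ∧
          6 ≤ (G.induce (S : Set V)).egirth := by
  classical
  have hex : ∀ t : ℕ, ∃ D₀ : ℕ, 1 ≤ t → ∀ D ≥ D₀, ∀ {α β : Type _} {r : α → β → Prop},
      BicliqueFree r t → ∀ (A : Finset α) (B : Finset β), A.Nonempty →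
        (∀ a ∈ A, 2 * D ≤ #(relNbrs r B a)) → (∀ a ∈ A, #(relNbrs r B a) ≤ 24 * D) →
        #B ≤ 2 * #A → HasDenseLinear r t A B := by
    intro t
    by_cases ht : 1 ≤ t
    · obtain ⟨D₀, h⟩ := exists_hasDenseLinear_of_degree_range ht
      exact ⟨D₀, fun _ => h⟩
    · exact ⟨0, fun h => absurd h ht⟩
  choose D₀ hD₀ using hex
  refine ⟨fun t => 4 * (D₀ t + 1), fun t V _ G hbip hdeg => ?_⟩
  by_cases hK : (completeBipartiteGraph (Fin t) (Fin t)).IsContained G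
  · exact Or.inl hK
  refine Or.inr ?_
  have hG := bicliqueFree_of_not_isContained hK
  -- For `t = 0` the empty biclique is always present.
  have ht : 1 ≤ t := by
    by_contra h0
    obtain rfl : t = 0 := by omega
    exact hG ∅ ∅ rfl rfl (by simp)
  obtain ⟨c₀⟩ := hbip
  let c : G.Coloring Bool := SimpleGraph.Coloring.mk (fun v => decide (c₀ v = 0)) fun {v w} h => by
    have := c₀.valid h
    simp only [ne_eq, decide_eq_decide]
    omega
  let c' : G.Coloring Bool := SimpleGraph.Coloring.mk (fun v => !c v) fun {v w} h => by
    have := c.valid h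
    simpa using this
  -- The `+ 1` in `f` makes it positive, which excludes the empty graph with its default average 0.
  have hU : (univ : Finset V).Nonempty := by
    rw [univ_nonempty_iff]
    by_contra hemp
    rw [not_nonempty_iff] at hemp
    simp [SimpleGraph.averageDegree] at hdeg
    have : (0 : ℚ) ≤ D₀ t := Nat.cast_nonneg _
    linarith
  have hsum : 4 * (D₀ t + 1) * #(univ : Finset V) ≤ ∑ v, #(relNbrs G.Adj univ v) := by
    unfold SimpleGraph.averageDegree at hdeg
    rw [le_div_iff₀ (by exact_mod_cast hU.card_pos)] at hdeg
    have h1 : ∀ v, #(relNbrs G.Adj univ v) = G.degree v := by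
      intro v
      rw [← SimpleGraph.card_neighborFinset_eq_degree, SimpleGraph.neighborFinset_eq_filter]
      rfl
    have h2 : 4 * (D₀ t + 1) * #(univ : Finset V) ≤ ∑ v, G.degree v := by
      rw [card_univ]
      have h3 : ((4 * (D₀ t + 1) * Fintype.card V : ℕ) : ℚ) ≤ ((∑ v, G.degree v : ℕ) : ℚ) := by
        push_cast at hdeg ⊢
        convert hdeg
      exact_mod_cast h3
    simpa only [h1] using h2
  obtain ⟨W, hW, hlow, hupW⟩ := exists_minDegree_lt_and_sum_le (G := G) (Nat.succ_pos (D₀ t)) hU hsum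
  rcases le_total #{v ∈ W | ¬ c v = true} #{v ∈ W | c v = true} with h | h
  · exact exists_induce_of_minDegree (hD₀ t ht _ (Nat.le_succ _)) (Nat.succ_pos _) hG c hW hlow hupW h
  · refine exists_induce_of_minDegree (hD₀ t ht _ (Nat.le_succ _)) (Nat.succ_pos _) hG c' hW hlow hupW ?_
    have e : ∀ v, c' v = true ↔ ¬ c v = true := fun v => by
      change (!c v) = true ↔ _
      simp
    simpa only [e, not_not] using h
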